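/- For $m\in\mathbb N$ let $\mathfrak D_m$ be the $m$-th level of the Hausdorff difference hierarchy on Cantor space: $D\in\mathfrak D_m$ iff there are open sets $U_0,\dots,U_{m-1}\subseteq\{0,1\}^{\mathbb N}$ such that $x\in D$ iff $\inf\{\beta\mid x\in U_\beta\}$ (with $\inf\emptyset=m$) and $m$ have different parity; a name of $D$ is a name of such a family, where an open set is named by an enumeration of finite words whose cylinders have that set as union. An input of $\mathrm{Det}_{\mathfrak D_m}$ and of $\mathrm{Win}_{\mathfrak D_m}$ is an infinite two-player win/lose game in which the players together build a sequence $x\in\{0,1\}^{\mathbb N}$ bit by bit; it is given by a look-up table $d:\{0,1\}^*\to\{1,2\}$ saying who moves after each finite history, and by a name of a set $D\in\mathfrak D_m$: player $1$ wins if $x\in D$, player $2$ wins otherwise. $\mathrm{Det}_{\mathfrak D_m}$ asks for a Nash equilibrium, i.e. a strategy profile $\{0,1\}^*\to\{0,1\}$ in which one of the two strategies is winning; $\mathrm{Win}_{\mathfrak D_m}$ asks which player has a winning strategy. Let $\mathrm C_{\{0,1\}^{\mathbb N}}$ be closed choice on Cantor space (given an enumeration of cylinders whose union is the complement of a non-empty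 closed set $A$, find a point of $A$), and let $\mathrm{LPO}:\mathbb N^{\mathbb N}\to\{0,1\}$ be the characteristic function of $\{0^{\mathbb N}\}$. For a problem $f$, its $n$-th jump $f^{[n]}$ is the same multivalued function with each input given by a name of it in the $n$-th jump of the input space, where the jump of a represented space $(X,\delta)$ is $(X,\delta\circ\lim)$ with $\lim(p)(k)=\lim_{i\to\infty}p(\langle k,i\rangle)$. Let $\equiv_{\mathrm W}$ be Weihrauch equivalence. Then for every $n\in\mathbb N$: $$\mathrm{Det}_{\mathfrak D_{n+1}}\equiv_{\mathrm W}\mathrm C_{\{0,1\}^{\mathbb N}}^{[n]}\qquad\text{and}\qquad \mathrm{Win}_{\mathfrak D_{n+1}}\equiv_{\mathrm W}\mathrm{LPO}^{[n]}.$$ -/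

import Mathlib

namespace WeihrauchGames

/-! ## Baire space, Cantor space and computable partial functions -/

/-- Baire space `ℕ^ℕ`. -/
abbrev Baire : Type := ℕ → ℕ

/-- Cantor space `{0,1}^ℕ`, with the product topology. -/
abbrev Cantor : Type := ℕ → Bool

/-- The finite prefix `x(0), …, x(k-1)` of an infinite sequence. -/
def pre {C : Type} (x : ℕ → C) (k : ℕ) : List C := (List.range k).map x

/-- Partial recursive functionals: the families of partial functions `φ^p` from `ℕ` to `ℕ` that
are computed by one and the same program from the oracle `p : ℕ → ℕ`, uniformly in `p`. The clauses
are those of `Nat.Partrec`, together with a clause for querying the oracle. -/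
inductive PartrecFunctional : (Baire → ℕ → Part ℕ) → Prop
  | zero : PartrecFunctional fun _ _ => Part.some 0
  | succ : PartrecFunctional fun _ n => Part.some (n + 1)
  | left : PartrecFunctional fun _ n => Part.some (Nat.unpair n).1
  | right : PartrecFunctional fun _ n => Part.some (Nat.unpair n).2
  | oracle : PartrecFunctional fun p n => Part.some (p n)
  | pair {f h : Baire → ℕ → Part ℕ} (hf : PartrecFunctional f) (hh : PartrecFunctional h) :
      PartrecFunctional fun p n => (f p n).bind fun a => (h p n).map fun b => Nat.pair a b
  | comp {f h : Baire → ℕ → Part ℕ} (hf : PartrecFunctional f) (hh : PartrecFunctional h) :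
      PartrecFunctional fun p n => (h p n).bind fun m => f p m
  | prec {f h : Baire → ℕ → Part ℕ} (hf : PartrecFunctional f) (hh : PartrecFunctional h) :
      PartrecFunctional fun p n =>
        Nat.rec (motive := fun _ => Part ℕ) (f p (Nat.unpair n).1)
          (fun y IH => IH.bind fun i => h p (Nat.pair (Nat.unpair n).1 (Nat.pair y i)))
          (Nat.unpair n).2
  | rfind {f : Baire → ℕ → Part ℕ} (hf : PartrecFunctional f) :
      PartrecFunctional fun p n =>
        Nat.rfind fun m => (f p (Nat.pair n m)).map fun v => decide (v = 0)

/-- A partial function `F :⊆ ℕ^ℕ → ℕ^ℕ` is computable if a single oracle program computes, for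
every `p ∈ dom F`, the sequence `F p` from the oracle `p`. -/
def ComputableOnBaire (F : Baire → Part Baire) : Prop :=
  ∃ φ : Baire → ℕ → Part ℕ, PartrecFunctional φ ∧ ∀ p q, q ∈ F p → ∀ n, q n ∈ φ p n

/-- The pairing `⟨p, q⟩ = p(0) q(0) p(1) q(1) …` of Baire space. -/
def pairB (p q : Baire) : Baire := fun n => if n % 2 = 0 then p (n / 2) else q (n / 2)

/-! ## Represented spaces -/

/-- A representation of `X`: a partial surjection from Baire space onto `X`, given by its graph.
`names p x` says that `p` is a name of `x`. -/
structure Representation (X : Type) where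
  names : Baire → X → Prop
  unique : ∀ p x y, names p x → names p y → x = y
  surj : ∀ x, ∃ p, names p x

/-- Baire space, represented by the identity. -/
def baireRep : Representation Baire where
  names p x := p = x
  unique := by rintro p x y rfl rfl; rfl
  surj x := ⟨x, rfl⟩

/-- A discrete countable space: a name of `y` starts with the code of `y`. -/
def discreteRep (Y : Type) [Encodable Y] : Representation Y where
  names p y := p 0 = Encodable.encode y
  unique _ _ _ hx hy := Encodable.encode_injective (hx.symm.trans hy)
  surj y := ⟨fun _ => Encodable.encode y, rfl⟩

/-- Functions between countable discrete spaces, represented by look-up tables. -/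
def tableRep (A Y : Type) [Encodable A] [Encodable Y] : Representation (A → Y) where
  names p f := ∀ a, p (Encodable.encode a) = Encodable.encode (f a)
  unique _ _ _ hf hg := funext fun a => Encodable.encode_injective ((hf a).symm.trans (hg a))
  surj f := ⟨fun m => ((Encodable.decode (α := A) m).map fun a => Encodable.encode (f a)).getD 0,
    fun a => by simp⟩

/-- Cantor space with its usual representation. -/
def cantorRep : Representation Cantor := tableRep ℕ Bool

/-- Binary product of represented spaces. -/
def prodRep {X Y : Type} (δ : Representation X) (ε : Representation Y) :
    Representation (X × Y) where
  names p z := δ.names (fun k => p (2 * k)) z.1 ∧ ε.names (fun k => p (2 * k + 1)) z.2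
  unique _ _ _ hx hy := Prod.ext (δ.unique _ _ _ hx.1 hy.1) (ε.unique _ _ _ hx.2 hy.2)
  surj z := by
    obtain ⟨p, hp⟩ := δ.surj z.1
    obtain ⟨q, hq⟩ := ε.surj z.2
    refine ⟨pairB p q, ?_, ?_⟩
    · have : (fun k => pairB p q (2 * k)) = p := by funext k; simp [pairB]
      rwa [this]
    · have : (fun k => pairB p q (2 * k + 1)) = q := by
        funext k
        have h1 : (2 * k + 1) % 2 = 1 := by omega
        have h2 : (2 * k + 1) / 2 = k := by omega
        simp [pairB, h1, h2]
      rwa [this]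

/-- `lim(p) = q` for the limit operator `lim(p)(n) = lim_i p(⟨n, i⟩)` on Baire space. -/
def IsLim (p q : Baire) : Prop :=
  ∀ n, ∀ᶠ i in Filter.atTop, p (Nat.pair n i) = q n

/-- The jump `(X, δ)' = (X, δ ∘ lim)` of a represented space. -/
def Representation.jump {X : Type} (δ : Representation X) : Representation X where
  names p x := ∃ q, IsLim p q ∧ δ.names q x
  unique := by
    rintro p x y ⟨q, hq, hx⟩ ⟨r, hr, hy⟩
    have : q = r := by
      funext n
      obtain ⟨i, hi⟩ := ((hq n).and (hr n)).exists
      exact hi.1.symm.trans hi.2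
    subst this
    exact δ.unique _ _ _ hx hy
  surj x := by
    obtain ⟨q, hq⟩ := δ.surj x
    exact ⟨fun m => q (Nat.unpair m).1, q, fun n => by simp, hq⟩

/-- The iterated jump `X^(n)`. -/
def Representation.iterJump {X : Type} (δ : Representation X) : ℕ → Representation X
  | 0 => δ
  | n + 1 => (δ.iterJump n).jump

/-! ## Multivalued functions and Weihrauch reducibility -/

/-- A partial multivalued function `f :⊆ X ⇉ Y` between represented spaces; its domain is
`{x | f x ≠ ∅}`. -/
structure Problem where
  X : Type
  Y : Type
  δX : Representation X
  δY : Representation Y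
  f : X → Set Y

/-- `F ⊢ f`: the partial function `F` on Baire space realizes `f`. -/
def Realizes (F : Baire → Part Baire) (P : Problem) : Prop :=
  ∀ p x, P.δX.names p x → (P.f x).Nonempty → ∃ q ∈ F p, ∃ y ∈ P.f x, P.δY.names q y

/-- Weihrauch reducibility: there are computable `K, H` such that `K⟨id, G H⟩ ⊢ f` for every
realizer `G ⊢ g`. -/
def WeihrauchLE (f g : Problem) : Prop :=
  ∃ K H : Baire → Part Baire, ComputableOnBaire K ∧ ComputableOnBaire H ∧
    ∀ G : Baire → Part Baire, Realizes G g →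
      Realizes (fun p => (H p).bind fun q => (G q).bind fun r => K (pairB p r)) f

/-- Weihrauch equivalence. -/
def WeihrauchEquiv (f g : Problem) : Prop := WeihrauchLE f g ∧ WeihrauchLE g f

/-- The `n`-th jump `f^[n] : X^(n) ⇉ Y` of `f : X ⇉ Y`. -/
def Problem.jump (P : Problem) (n : ℕ) : Problem := { P with δX := P.δX.iterJump n }

/-! ## Open and closed subsets of Cantor space, closed choice, LPO -/

/-- The open set enumerated by `p`: the union of the cylinders `[w]` over all finite words `w`
whose code plus one occurs in the sequence `p` (an entry `0` carries no information). -/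
def openOf (p : Baire) : Set Cantor :=
  {x | ∃ i k, p i = Encodable.encode (pre x k) + 1}

theorem pre_congr {x y : Cantor} {k : ℕ} (h : pre y k = pre x k) : ∀ i < k, y i = x i := by
  intro i hi
  simpa [pre, hi] using congrArg (fun l : List Bool => l[i]?) h

theorem isOpen_openOf (p : Baire) : IsOpen (openOf p) := by
  rw [isOpen_iff_forall_mem_open]
  rintro x ⟨i, k, hx⟩
  refine ⟨PiNat.cylinder x k, ?_, PiNat.isOpen_cylinder _ x k, PiNat.self_mem_cylinder x k⟩
  intro y hy
  refine ⟨i, k, ?_⟩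
  have : pre y k = pre x k := by
    simp only [pre]
    apply List.map_congr_left
    intro a ha
    exact hy a (List.mem_range.1 ha)
  rw [this, hx]

theorem exists_openOf {U : Set Cantor} (hU : IsOpen U) : ∃ p, openOf p = U := by
  classical
  refine ⟨fun i => if ∃ w : List Bool, Encodable.encode w = i ∧
    ∀ x : Cantor, pre x w.length = w → x ∈ U then i + 1 else 0, ?_⟩
  ext x
  constructor
  · rintro ⟨i, k, h⟩
    dsimp only at h
    split_ifs at h with hw
    obtain ⟨w, hw, hall⟩ := hw
    have hw' : w = pre x k := Encodable.encode_injective (by omega)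
    subst hw'
    exact hall x (by simp [pre])
  · intro hx
    obtain ⟨_, ⟨y, k, rfl⟩, hxy, hsub⟩ :=
      (PiNat.isTopologicalBasis_cylinders (fun _ : ℕ => Bool)).isOpen_iff.1 hU x hx
    refine ⟨Encodable.encode (pre x k), k, ?_⟩
    refine if_pos ?_
    refine ⟨pre x k, rfl, fun z hz => hsub ?_⟩
    have hz' : pre z k = pre x k := by simpa [pre] using hz
    intro i hi
    rw [pre_congr hz' i hi]
    exact hxy i hi

/-- The space `𝒜({0,1}^ℕ)` of closed subsets of Cantor space: a name of `A` is a sequence that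
enumerates the open complement of `A`. -/
def closedRep : Representation (TopologicalSpace.Closeds Cantor) where
  names p A := (A : Set Cantor) = (openOf p)ᶜ
  unique _ _ _ hx hy := TopologicalSpace.Closeds.ext (hx.trans hy.symm)
  surj A := by
    obtain ⟨p, hp⟩ := exists_openOf A.isClosed.isOpen_compl
    exact ⟨p, by rw [hp, compl_compl]⟩

/-- Closed choice `C_{{0,1}^ℕ}`: given a non-empty closed set, find one of its points. -/
def closedChoice : Problem where
  X := TopologicalSpace.Closeds Cantor
  Y := Cantor
  δX := closedRep
  δY := cantorRep
  f A := A

open Classical in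
/-- `LPO`: the characteristic function of the constant sequence `0^ℕ` on Baire space. -/
noncomputable def LPO : Problem where
  X := Baire
  Y := Bool
  δX := baireRep
  δY := discreteRep Bool
  f p := {decide (p = fun _ => 0)}

/-! ## Represented pointclasses and the finite levels of the difference hierarchy -/

/-- A represented pointclass over Cantor space. -/
structure Pointclass where
  sets : Set (Set Cantor)
  rep : Representation sets

/-- The set defined by a family `(U_β)_{β < n}`: a point `x` belongs to it iff the parity of
`inf {β | x ∈ U_β}` differs from the parity of `n`, where `inf ∅ = n`. -/
def diffSet {n : ℕ} (U : Fin n → Set Cantor) : Set Cantor :=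
  {x | sInf (insert n {β : ℕ | ∃ i : Fin n, (i : ℕ) = β ∧ x ∈ U i}) % 2 ≠ n % 2}

/-- The `n`-th level `𝔇_n` of the Hausdorff difference hierarchy; a name of a set is a name of a
family of open sets that defines it. -/
def diffClass (n : ℕ) : Pointclass where
  sets := {A | ∃ U : Fin n → Set Cantor, (∀ i, IsOpen (U i)) ∧ A = diffSet U}
  rep :=
    { names := fun p A =>
        (A : Set Cantor) = diffSet fun i : Fin n => openOf fun k => p (Nat.pair i k)
      unique := fun _ _ _ hx hy => Subtype.ext (hx.trans hy.symm)
      surj := by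
        rintro ⟨A, U, hU, hA⟩
        choose p hp using fun i => exists_openOf (hU i)
        refine ⟨fun m => if h : (Nat.unpair m).1 < n then p ⟨_, h⟩ (Nat.unpair m).2 else 0, ?_⟩
        simp [hA, hp] }

/-! ## Infinite sequential games -/

/-- An infinite sequential game with agents `A`, choices `C` and outcomes `O`: a turn function,
a valuation of the plays, and for every agent `a` a preference `pref a o o'` (`a` prefers `o'`
to `o`). -/
structure SeqGame (A C O : Type) where
  turn : List C → A
  val : (ℕ → C) → O
  pref : A → O → O → Prop

/-- The prefixes of the play induced by a strategy profile. -/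
def playPrefix {C : Type} (σ : List C → C) : ℕ → List C
  | 0 => []
  | n + 1 => playPrefix σ n ++ [σ (playPrefix σ n)]

/-- The play induced by a strategy profile. -/
def play {C : Type} (σ : List C → C) : ℕ → C := fun n => σ (playPrefix σ n)

/-- `σ` is a Nash equilibrium: no agent `a` prefers the outcome of a profile `τ` that arises
from `σ` by changing the choices of `a` only. -/
def SeqGame.IsNash {A C O : Type} (G : SeqGame A C O) (σ : List C → C) : Prop :=
  ∀ (a : A) (τ : List C → C), (∀ h, G.turn h ≠ a → τ h = σ h) →
    ¬ G.pref a (G.val (play σ)) (G.val (play τ))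

/-- The two players of a win/lose game: `0` is the first player, `1` the second. -/
abbrev Player : Type := Fin 2

open Classical in
/-- The win/lose game on Cantor space with the given turn function in which the first player wins
exactly the plays in `W`. The outcome is the winner, and every player prefers to win. -/
noncomputable def winLose (turn : List Bool → Player) (W : Set Cantor) :
    SeqGame Player Bool Player where
  turn := turn
  val x := if x ∈ W then 0 else 1
  pref a o o' := o ≠ a ∧ o' = a

/-- Player `a` has a winning strategy: there are choices at the histories of `a` such that `a`
wins every play in which these choices are followed. -/
def HasWinningStrategy (G : SeqGame Player Bool Player) (a : Player) : Prop :=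
  ∃ σ : List Bool → Bool, ∀ τ : List Bool → Bool,
    (∀ h, G.turn h = a → τ h = σ h) → G.val (play τ) = a

/-- `Det_Γ`: given a two-player win/lose game (the turn function as a look-up table, and the
winning set of the first player as an element of `Γ`), find a Nash equilibrium. -/
noncomputable def Det (Γ : Pointclass) : Problem where
  X := (List Bool → Player) × Γ.sets
  Y := List Bool → Bool
  δX := prodRep (tableRep (List Bool) Player) Γ.rep
  δY := tableRep (List Bool) Bool
  f g := {σ | (winLose g.1 g.2).IsNash σ}

/-- `Win_Γ`: given a game as for `Det_Γ`, decide which player has a winning strategy. -/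
noncomputable def Win (Γ : Pointclass) : Problem where
  X := (List Bool → Player) × Γ.sets
  Y := Player
  δX := prodRep (tableRep (List Bool) Player) Γ.rep
  δY := discreteRep Player
  f g := {a | HasWinningStrategy (winLose g.1 g.2) a}

end WeihrauchGames

/-! ### Uniform computability: bounded oracle use, iterated limits, and names in iterated jumps. -/

namespace WeihrauchGames

open Encodable Filter

/-! ## Total computable functionals -/

/-! Upper bounds. A set of level m+1 is U minus a set of level m, where U is the union of the first
m+1 open sets (`mem_diffSet_succ`). To force the play into it, an agent must force, in finitely many
moves, a position known to lie in U at which the opponent cannot force level m. A finite list of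
words witnesses this, so each level of `Att` adds one existential quantifier and hence one limit
(`limDec_att`). Optimal moves cost no more than that. At a position not known to lie in U, the
attacker prefers the successor whose witness appears earlier, and the defender the other one; this
is a universal condition on a single move. At known positions the roles swap and level m takes over.
The profiles with only such moves (`Allowed`) form a non-empty closed set, named by an n-fold limit
when the level is n+1, and in each of them the winner's moves are a winning strategy
(`Allowed.optimal`). So the n-th jump of closed choice finds an equilibrium. The winner is given by
one existential quantifier over a predicate decided by n limits, which the n-th jump of `LPO`
evaluates.

Lower bounds. In the picking game the agents alternately name n+3 numbers, the second of which is a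
bit; whoever stalls loses, and the number of missing picks is the index in the difference hierarchy.
Winning it is the truth of an alternating block of quantifiers. At a limit, `∃ y, ψ` is equivalent
to `∃ (y, N), ∀ t ≥ N, ψ` evaluated at column t, so a jump costs one extra pick
(`moverWins_jumpPred`), and the last n+1 picks decide a Σ₁-statement about an n-fold limit. For
`LPO` the first two picks are idle and the statement says that the sequence is not zero. For closed
choice, agent 0 picks a word w, agent 1 answers a bit b, and the statement says that the cylinder of
wb is seen to be covered at a stage when that of w(¬b) is not. This cannot hold for both bits, so
agent 1 wins, and an equilibrium answers every w correctly (`not_moverWins_of_isNash`). Following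
the answers from the empty word avoids covered cylinders and yields a point of the closed set. -/

theorem PartrecFunctional.of_primrec {f : ℕ → ℕ} (hf : Nat.Primrec f) :
    PartrecFunctional fun _ n => Part.some (f n) := by
  induction hf with
  | zero => exact .zero
  | succ => exact .succ
  | left => exact .left
  | right => exact .right
  | pair _ _ hf hg => simpa using hf.pair hg
  | comp _ _ hf hg => simpa using hf.comp hg
  | @prec f g _ _ hf hg =>
    convert hf.prec hg using 3 with p n
    simp only [Nat.unpaired]
    induction (Nat.unpair n).2 with
    | zero => rfl
    | succ m IH => simp only [← IH, Part.bind_some]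

/-- `Θ` is computed by an oracle program that terminates on all oracles. -/
def TotalFunctional (Θ : Baire → ℕ → ℕ) : Prop :=
  PartrecFunctional fun p n => Part.some (Θ p n)

namespace TotalFunctional

variable {Θ Ψ : Baire → ℕ → ℕ}

theorem of_primrec {f : ℕ → ℕ} (hf : Primrec f) : TotalFunctional fun _ n => f n :=
  PartrecFunctional.of_primrec (Primrec.nat_iff.1 hf)

theorem oracle : TotalFunctional fun p n => p n := PartrecFunctional.oracle

theorem pair (h₁ : TotalFunctional Θ) (h₂ : TotalFunctional Ψ) :
    TotalFunctional fun p n => Nat.pair (Θ p n) (Ψ p n) := by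
  simpa [TotalFunctional] using PartrecFunctional.pair h₁ h₂

theorem comp (h₁ : TotalFunctional Θ) (h₂ : TotalFunctional Ψ) :
    TotalFunctional fun p n => Θ p (Ψ p n) := by
  simpa [TotalFunctional] using PartrecFunctional.comp h₁ h₂

theorem prec (h₁ : TotalFunctional Θ) (h₂ : TotalFunctional Ψ) :
    TotalFunctional fun p n => Nat.rec (motive := fun _ => ℕ) (Θ p n.unpair.1)
      (fun y i => Ψ p (Nat.pair n.unpair.1 (Nat.pair y i))) n.unpair.2 := by
  have := PartrecFunctional.prec h₁ h₂
  unfold TotalFunctional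
  convert this using 3 with p n
  dsimp only
  induction (Nat.unpair n).2 with
  | zero => rfl
  | succ m IH => simp only [← IH, Part.bind_some]

theorem computableOnBaire (h : TotalFunctional Θ) :
    ComputableOnBaire fun p => Part.some (Θ p) :=
  ⟨_, h, fun p q hq n => by rw [Part.mem_some_iff.1 hq]; exact Part.mem_some _⟩

end TotalFunctional

/-! ## Functionals of primitive recursively bounded use -/

theorem pre_take {C : Type} (x : ℕ → C) {i k : ℕ} (h : i ≤ k) : (pre x k).take i = pre x i := by
  simp [pre, ← List.map_take, List.take_range, h]

theorem pre_succ {C : Type} (x : ℕ → C) (k : ℕ) : pre x (k + 1) = pre x k ++ [x k] := by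
  simp [pre, List.range_succ]

@[simp] theorem length_pre {C : Type} (x : ℕ → C) (k : ℕ) : (pre x k).length = k := by simp [pre]

theorem TotalFunctional.encode_pre : TotalFunctional fun p k => encode (pre p k) := by
  have hstep : Primrec fun m : ℕ =>
      encode (((decode (α := List ℕ) m.unpair.1).getD []) ++ [m.unpair.2]) := by
    refine Primrec.encode.comp (Primrec.list_concat.comp
      (Primrec.option_getD.comp (Primrec.decode.comp (Primrec.fst.comp Primrec.unpair))
        (Primrec.const [])) (Primrec.snd.comp Primrec.unpair))
  have hu : Primrec fun n : ℕ => n.unpair.2.unpair.1 :=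
    Primrec.fst.comp (Primrec.unpair.comp (Primrec.snd.comp Primrec.unpair))
  have hv : Primrec fun n : ℕ => n.unpair.2.unpair.2 :=
    Primrec.snd.comp (Primrec.unpair.comp (Primrec.snd.comp Primrec.unpair))
  have h := (of_primrec (Primrec.const (encode ([] : List ℕ)))).prec
    ((of_primrec hstep).comp ((of_primrec hv).pair (oracle.comp (of_primrec hu))))
  have h' := h.comp (of_primrec (Primrec₂.natPair.comp (Primrec.const 0) Primrec.id))
  convert h' using 3 with p k
  simp only [Nat.unpair_pair, id]
  induction k with
  | zero => rfl
  | succ k IH => rw [pre_succ]; simp only [← IH]; simp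

section Classes

variable {α β γ : Type} [Primcodable α] [Primcodable β] [Primcodable γ]

/-- `F p a` is a primitive recursive function of `a` and a prefix of the oracle `p` whose length
is primitive recursive in `a`. -/
def BoundedUse (F : Baire → α → β) : Prop :=
  ∃ (u : α → ℕ) (g : α → List ℕ → β), Primrec u ∧ Primrec₂ g ∧ ∀ p a, F p a = g a (pre p (u a))

theorem BoundedUse.totalFunctional {F : Baire → ℕ → ℕ} (hF : BoundedUse F) :
    TotalFunctional F := by
  obtain ⟨u, g, hu, hg, h⟩ := hF
  have hG : Primrec fun m : ℕ => g m.unpair.1 ((decode (α := List ℕ) m.unpair.2).getD []) :=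
    hg.comp (Primrec.fst.comp Primrec.unpair) (Primrec.option_getD.comp
      (Primrec.decode.comp (Primrec.snd.comp Primrec.unpair)) (Primrec.const []))
  have := (TotalFunctional.of_primrec hG).comp ((TotalFunctional.of_primrec Primrec.id).pair
    (TotalFunctional.encode_pre.comp (TotalFunctional.of_primrec hu)))
  convert this using 3 with p n
  simp [h]

namespace BoundedUse

theorem of_primrec {f : α → β} (hf : Primrec f) : BoundedUse fun _ a => f a :=
  ⟨fun _ => 0, fun a _ => f a, Primrec.const 0, hf.comp Primrec.fst, fun _ _ => rfl⟩

theorem oracle : BoundedUse fun p (k : ℕ) => p k :=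
  ⟨fun k => k + 1, fun k l => l.getD k 0, Primrec.succ,
    (Primrec.list_getD 0).comp Primrec.snd Primrec.fst, fun p k => by simp [pre]⟩

theorem comp {F : Baire → β → γ} (hF : BoundedUse F) {f : α → β} (hf : Primrec f) :
    BoundedUse fun p a => F p (f a) := by
  obtain ⟨u, g, hu, hg, h⟩ := hF
  exact ⟨fun a => u (f a), fun a l => g (f a) l, hu.comp hf,
    hg.comp (hf.comp Primrec.fst) Primrec.snd, fun p a => h p (f a)⟩

theorem map {F : Baire → α → β} (hF : BoundedUse F) {f : β → γ} (hf : Primrec f) :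
    BoundedUse fun p a => f (F p a) := by
  obtain ⟨u, g, hu, hg, h⟩ := hF
  exact ⟨u, fun a l => f (g a l), hu, hf.comp hg, fun p a => by simp only [h]⟩

theorem pair {F : Baire → α → β} {G : Baire → α → γ} (hF : BoundedUse F) (hG : BoundedUse G) :
    BoundedUse fun p a => (F p a, G p a) := by
  obtain ⟨u, g, hu, hg, h⟩ := hF
  obtain ⟨u', g', hu', hg', h'⟩ := hG
  refine ⟨fun a => u a + u' a, fun a l => (g a (l.take (u a)), g' a (l.take (u' a))),
    Primrec.nat_add.comp hu hu', Primrec.pair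
      (hg.comp Primrec.fst (Primrec.list_take.comp (hu.comp Primrec.fst) Primrec.snd))
      (hg'.comp Primrec.fst (Primrec.list_take.comp (hu'.comp Primrec.fst) Primrec.snd)), ?_⟩
  intro p a
  simp only [h, h']
  rw [pre_take _ (by omega), pre_take _ (by omega)]

/-- A single prefix serves all entries: its length is the maximum of their uses. -/
theorem listMap {F : Baire → α × γ → β} (hF : BoundedUse F) {l : α → List γ} (hl : Primrec l) :
    BoundedUse fun p a => (l a).map fun c => F p (a, c) := by
  obtain ⟨u, g, hu, hg, h⟩ := hF
  have huu : Primrec₂ fun (a : α) (q : γ × ℕ) => max (u (a, q.1)) q.2 :=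
    Primrec.nat_max.comp (hu.comp (Primrec.pair Primrec.fst (Primrec.fst.comp Primrec.snd)))
      (Primrec.snd.comp Primrec.snd)
  refine ⟨fun a => (l a).foldr (fun c r => max (u (a, c)) r) 0,
    fun a L => (l a).map fun c => g (a, c) (L.take (u (a, c))),
    Primrec.list_foldr hl (Primrec.const 0) huu, ?_, ?_⟩
  · have hac : Primrec fun z : (α × List ℕ) × γ => (z.1.1, z.2) :=
      Primrec.pair (Primrec.fst.comp Primrec.fst) Primrec.snd
    exact Primrec.list_map (hl.comp Primrec.fst) (hg.comp hac
      (Primrec.list_take.comp (hu.comp hac) (Primrec.snd.comp Primrec.fst)))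
  · intro p a
    refine List.map_congr_left fun c hc => ?_
    rw [h, pre_take]
    dsimp only
    generalize l a = L at hc
    induction L with
    | nil => simp at hc
    | cons d L IH =>
      rcases List.mem_cons.1 hc with rfl | hc
      · simp
      · exact (IH hc).trans (by simp)

/-- Because the use is bounded in advance, the finitely many values of the substituted oracle can be
listed before `F` runs. -/
theorem subst {F : Baire → β → γ} (hF : BoundedUse F) {R : Baire → α × ℕ → ℕ}
    (hR : BoundedUse R) {f : α → β} (hf : Primrec f) :
    BoundedUse fun p a => F (fun k => R p (a, k)) (f a) := by
  obtain ⟨u, g, hu, hg, h⟩ := hF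
  have h₁ := (of_primrec (α := α) Primrec.id).pair (hR.listMap (l := fun a => List.range (u (f a)))
    (Primrec.list_range.comp (hu.comp hf)))
  have h₂ := h₁.map (f := fun q : α × List ℕ => g (f q.1) q.2)
    (hg.comp (hf.comp Primrec.fst) Primrec.snd)
  convert h₂ using 3 with p a
  rw [h]
  rfl

end BoundedUse

/-! ## Iterated limits -/

/-- `F` is an `n`-fold limit of functionals of bounded use. -/
def LimUse : ℕ → ∀ {α β : Type} [Primcodable α] [Primcodable β], (Baire → α → β) → Prop
  | 0, _, _, _, _, F => BoundedUse F
  | n + 1, α, β, _, _, F => ∃ F' : Baire → α × ℕ → β, LimUse n F' ∧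
      ∀ p a, ∀ᶠ i in atTop, F' p (a, i) = F p a

namespace LimUse

variable {n : ℕ}

theorem comp {F : Baire → β → γ} (hF : LimUse n F) {f : α → β} (hf : Primrec f) :
    LimUse n fun p a => F p (f a) := by
  induction n generalizing α β with
  | zero => exact BoundedUse.comp hF hf
  | succ n IH =>
    obtain ⟨F', hF', h⟩ := hF
    exact ⟨fun p a => F' p (f a.1, a.2),
      IH hF' (Primrec.pair (hf.comp Primrec.fst) Primrec.snd), fun p a => h p (f a)⟩

theorem succ {F : Baire → α → β} (hF : LimUse n F) : LimUse (n + 1) F :=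
  ⟨fun p a => F p a.1, hF.comp Primrec.fst, fun _ _ => by simp⟩

theorem of_boundedUse {F : Baire → α → β} (hF : BoundedUse F) : LimUse n F := by
  induction n with
  | zero => exact hF
  | succ n IH => exact IH.succ

theorem of_primrec {f : α → β} (hf : Primrec f) : LimUse n fun _ a => f a :=
  of_boundedUse (.of_primrec hf)

theorem map {F : Baire → α → β} (hF : LimUse n F) {f : β → γ} (hf : Primrec f) :
    LimUse n fun p a => f (F p a) := by
  induction n generalizing α with
  | zero => exact BoundedUse.map hF hf
  | succ n IH =>
    obtain ⟨F', hF', h⟩ := hF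
    exact ⟨fun p a => f (F' p a), IH hF', fun p a => (h p a).mono fun i hi => by simp only [hi]⟩

theorem pair {F : Baire → α → β} {G : Baire → α → γ} (hF : LimUse n F) (hG : LimUse n G) :
    LimUse n fun p a => (F p a, G p a) := by
  induction n generalizing α with
  | zero => exact BoundedUse.pair hF hG
  | succ n IH =>
    obtain ⟨F', hF', h⟩ := hF
    obtain ⟨G', hG', h'⟩ := hG
    exact ⟨fun p a => (F' p a, G' p a), IH hF' hG',
      fun p a => ((h p a).and (h' p a)).mono fun i hi => by simp only [hi.1, hi.2]⟩

theorem listMap {F : Baire → α × γ → β} (hF : LimUse n F) {l : α → List γ} (hl : Primrec l) :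
    LimUse n fun p a => (l a).map fun c => F p (a, c) := by
  induction n generalizing α with
  | zero => exact BoundedUse.listMap hF hl
  | succ n IH =>
    obtain ⟨F', hF', h⟩ := hF
    have hF'' : LimUse n fun p (z : (α × ℕ) × γ) => F' p ((z.1.1, z.2), z.1.2) :=
      hF'.comp (Primrec.pair (Primrec.pair (Primrec.fst.comp Primrec.fst) Primrec.snd)
        (Primrec.snd.comp Primrec.fst))
    refine ⟨_, IH hF'' (hl.comp Primrec.fst), fun p a => ?_⟩
    have hall : ∀ L : List γ, ∀ᶠ i in atTop, ∀ c ∈ L, F' p ((a, c), i) = F p (a, c) := by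
      intro L
      induction L with
      | nil => simp
      | cons d L IHL =>
        filter_upwards [h p (a, d), IHL] with i h₁ h₂
        simpa [h₁] using h₂
    exact (hall (l a)).mono fun i hi => List.map_congr_left hi

theorem ite_bool {c : Baire → α → Bool} {F G : Baire → α → β} (hc : LimUse n c)
    (hF : LimUse n F) (hG : LimUse n G) :
    LimUse n fun p a => bif c p a then F p a else G p a :=
  (hc.pair (hF.pair hG)).map (f := fun z : Bool × β × β => bif z.1 then z.2.1 else z.2.2)
    (Primrec.cond Primrec.fst (Primrec.fst.comp Primrec.snd) (Primrec.snd.comp Primrec.snd))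

end LimUse

/-- The predicate `P` is decided by an `n`-fold limit of functionals of bounded use. -/
def LimDec (n : ℕ) (P : Baire → α → Prop) : Prop :=
  ∃ F : Baire → α → Bool, LimUse n F ∧ ∀ p a, F p a = true ↔ P p a

namespace LimDec

variable {n : ℕ} {P Q : Baire → α → Prop}

theorem of_iff (hP : LimDec n P) (h : ∀ p a, Q p a ↔ P p a) : LimDec n Q := by
  obtain ⟨F, hF, hFP⟩ := hP
  exact ⟨F, hF, fun p a => (hFP p a).trans (h p a).symm⟩

theorem comp {P : Baire → β → Prop} (hP : LimDec n P) {f : α → β} (hf : Primrec f) :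
    LimDec n fun p a => P p (f a) := by
  obtain ⟨F, hF, h⟩ := hP
  exact ⟨_, hF.comp hf, fun p a => h p (f a)⟩

theorem of_primrecPred {R : α → Prop} (hR : PrimrecPred R) : LimDec n fun _ a => R a := by
  obtain ⟨_, hR⟩ := hR
  exact ⟨_, LimUse.of_primrec hR, fun p a => by simp⟩

theorem const (R : Prop) : LimDec n fun (_ : Baire) (_ : α) => R := by
  classical
  exact ⟨_, LimUse.of_primrec (Primrec.const (decide R)), fun p a => by simp⟩

theorem not (hP : LimDec n P) : LimDec n fun p a => ¬ P p a := by
  obtain ⟨F, hF, h⟩ := hP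
  exact ⟨_, hF.map Primrec.not, fun p a => by simp [← h]⟩

theorem and (hP : LimDec n P) (hQ : LimDec n Q) : LimDec n fun p a => P p a ∧ Q p a := by
  obtain ⟨F, hF, h⟩ := hP
  obtain ⟨G, hG, h'⟩ := hQ
  exact ⟨_, (hF.pair hG).map (f := fun z => z.1 && z.2)
    (Primrec.and.comp Primrec.fst Primrec.snd), fun p a => by simp [← h, ← h']⟩

theorem or (hP : LimDec n P) (hQ : LimDec n Q) : LimDec n fun p a => P p a ∨ Q p a :=
  (hP.not.and hQ.not).not.of_iff fun p a => by tauto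

theorem imp (hP : LimDec n P) (hQ : LimDec n Q) : LimDec n fun p a => P p a → Q p a :=
  (hP.and hQ.not).not.of_iff fun p a => by tauto

theorem eq {F G : Baire → α → β} (hF : LimUse n F) (hG : LimUse n G) :
    LimDec n fun p a => F p a = G p a := by
  obtain ⟨_, h⟩ := Primrec.eq (α := β)
  exact ⟨_, (hF.pair hG).map h, fun p a => by simp⟩

theorem forall_mem {P : Baire → α × γ → Prop} (hP : LimDec n P) {l : α → List γ}
    (hl : Primrec l) : LimDec n fun p a => ∀ c ∈ l a, P p (a, c) := by
  obtain ⟨F, hF, h⟩ := hP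
  have hand : Primrec₂ fun (_ : List Bool) (q : Bool × Bool) => q.1 && q.2 :=
    Primrec.and.comp (Primrec.fst.comp Primrec.snd) (Primrec.snd.comp Primrec.snd)
  have hall : Primrec fun L : List Bool => L.foldr (fun b r => b && r) true :=
    (Primrec.list_foldr Primrec.id (Primrec.const true) hand).of_eq fun _ => rfl
  refine ⟨_, (hF.listMap hl).map hall, fun p a => ?_⟩
  dsimp only
  induction l a with
  | nil => simp
  | cons d L IH => simp [IH, h]

theorem exists_mem {P : Baire → α × γ → Prop} (hP : LimDec n P) {l : α → List γ}
    (hl : Primrec l) : LimDec n fun p a => ∃ c ∈ l a, P p (a, c) :=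
  (hP.not.forall_mem hl).not.of_iff fun p a => by push Not; rfl

theorem exists_lt {P : Baire → α × ℕ → Prop} (hP : LimDec n P) {u : α → ℕ} (hu : Primrec u) :
    LimDec n fun p a => ∃ c < u a, P p (a, c) :=
  (hP.exists_mem (Primrec.list_range.comp hu)).of_iff fun p a => by simp

/-- The search below `i` changes its answer at most once as `i` grows, so an unbounded quantifier
costs one limit. -/
theorem exists_nat {P : Baire → α × ℕ → Prop} (hP : LimDec n P) :
    LimDec (n + 1) fun p a => ∃ c, P p (a, c) := by
  have h := (hP.comp (f := fun z : (α × ℕ) × ℕ => (z.1.1, z.2))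
    (Primrec.pair (Primrec.fst.comp Primrec.fst) Primrec.snd)).exists_lt
    (u := fun z : α × ℕ => z.2) Primrec.snd
  obtain ⟨F, hF, h⟩ := h
  classical
  refine ⟨fun p a => decide (∃ c, P p (a, c)), ⟨F, hF, fun p a => ?_⟩, fun p a => by simp⟩
  by_cases hc : ∃ c, P p (a, c)
  · obtain ⟨c, hc⟩ := hc
    filter_upwards [eventually_gt_atTop c] with i hi
    have : F p (a, i) = true := (h p (a, i)).2 ⟨c, hi, hc⟩
    simpa [this] using ⟨c, hc⟩
  · refine Eventually.of_forall fun i => ?_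
    have : F p (a, i) = false := by
      rw [← Bool.not_eq_true, h]
      exact fun ⟨c, _, h'⟩ => hc ⟨c, h'⟩
    simpa [this] using hc

theorem forall_nat {P : Baire → α × ℕ → Prop} (hP : LimDec n P) :
    LimDec (n + 1) fun p a => ∀ c, P p (a, c) :=
  hP.not.exists_nat.not.of_iff fun p a => by push Not; rfl

end LimDec

end Classes

/-! ## Iterated jumps of representations -/

/-- `q` is the `n`-fold limit of `p`. -/
def IsIterLim : ℕ → Baire → Baire → Prop
  | 0, p, q => p = q
  | n + 1, p, q => ∃ r, IsLim p r ∧ IsIterLim n r q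

theorem IsIterLim.append_isLim {n : ℕ} {p q r : Baire} (h : IsIterLim n p q) (hr : IsLim q r) :
    IsIterLim (n + 1) p r := by
  induction n generalizing p with
  | zero => cases h; exact ⟨r, hr, rfl⟩
  | succ n IH =>
    obtain ⟨s, hs, h⟩ := h
    exact ⟨s, hs, IH h⟩

theorem Representation.iterJump_names {X : Type} (δ : Representation X) {n : ℕ} {p : Baire}
    {x : X} : (δ.iterJump n).names p x ↔ ∃ q, IsIterLim n p q ∧ δ.names q x := by
  induction n generalizing p with
  | zero => exact ⟨fun h => ⟨p, rfl, h⟩, by rintro ⟨_, rfl, h⟩; exact h⟩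
  | succ n IH =>
    constructor
    · rintro ⟨r, hr, h⟩
      obtain ⟨q, hq, h⟩ := IH.1 h
      exact ⟨q, ⟨r, hr, hq⟩, h⟩
    · rintro ⟨q, ⟨r, hr, hq⟩, h⟩
      exact ⟨r, hr, IH.2 ⟨q, hq, h⟩⟩

/-- Folding the index of the outermost limit into the argument by `Nat.unpair` matches the coding of
`IsLim`. This turns an n-fold limit into the name required by an n-th jump. -/
theorem LimUse.exists_isIterLim {n : ℕ} {F : Baire → ℕ → ℕ} (hF : LimUse n F) :
    ∃ G : Baire → ℕ → ℕ, BoundedUse G ∧ ∀ p, IsIterLim n (G p) (F p) := by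
  induction n generalizing F with
  | zero => exact ⟨F, hF, fun _ => rfl⟩
  | succ n IH =>
    obtain ⟨F', hF', h⟩ := hF
    obtain ⟨G, hG, hGF⟩ := IH (hF'.comp Primrec.unpair)
    exact ⟨G, hG, fun p => (hGF p).append_isLim fun k => by simpa using h p k⟩

end WeihrauchGames

/-! ### Optimal play in games of the difference hierarchy. -/

namespace WeihrauchGames

open Encodable Filter

/-! ## Values of positions in games of the difference hierarchy -/

theorem Player.eq_swap_iff {a c : Player} : c = 1 - a ↔ c ≠ a := by
  revert a c; decide

theorem Player.swap_swap (a : Player) : 1 - (1 - a) = a := by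
  revert a; decide

/-- Every word of the list `L` is a target, or agent `a` can force the play to continue in `L`. -/
def IsForcing (turn : List Bool → Player) (T : List Bool → Prop) (a : Player)
    (L : List (List Bool)) : Prop :=
  ∀ w ∈ L, T w ∨ (turn w = a ∧ ∃ b, w ++ [b] ∈ L) ∨ (turn w ≠ a ∧ ∀ b, w ++ [b] ∈ L)

/-- The predicate `T s` grows with the stage `s`. -/
def StageMono (T : ℕ → List Bool → Prop) : Prop :=
  ∀ ⦃s t w⦄, s ≤ t → T s w → T t w

/-- A list with code below `s` witnesses that agent `a` can force the play into a target at
stage `s`. -/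
def Reach (turn : List Bool → Player) (T : ℕ → List Bool → Prop) (a : Player) (s : ℕ)
    (v : List Bool) : Prop :=
  ∃ c < s, ∃ L, decode (α := List (List Bool)) c = some L ∧ v ∈ L ∧ IsForcing turn (T s) a L

/-- The relation `R m s` grows with the stage `s`, and it is preserved by extending the position. -/
structure IsRecognition (R : ℕ → ℕ → List Bool → Prop) : Prop where
  mono : ∀ m, StageMono (R m)
  concat : ∀ {m s w} (b : Bool), R m s w → R m s (w ++ [b])

/-- The targets of the attacker at the `m + 1`-st level, given the winning positions of the
defender at the `m`-th level. -/
def Target (R : ℕ → ℕ → List Bool → Prop) (m : ℕ) (W : List Bool → Prop) (s : ℕ)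
    (w : List Bool) : Prop :=
  R m s w ∧ ¬ W w

/-- The positions from which agent `a` can force the play into the `m`-th difference set. The
relation `R m s` holds at the positions that at stage `s` are known to lie in the union of the
first `m + 1` open sets. -/
def Att (turn : List Bool → Player) (R : ℕ → ℕ → List Bool → Prop) :
    ℕ → Player → List Bool → Prop
  | 0, _, _ => False
  | m + 1, a, v => ∃ s, Reach turn (Target R m (Att turn R m (1 - a))) a s v

/-- `b` is no worse than the other move at `v`: the attacker `a` prefers the move after which a
target is reached at an earlier stage, and the defender the other one. -/
def NoWorse (turn : List Bool → Player) (T : ℕ → List Bool → Prop) (a : Player)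
    (v : List Bool) (b : Bool) (s : ℕ) : Prop :=
  (turn v = a → Reach turn T a s (v ++ [!b]) → Reach turn T a s (v ++ [b])) ∧
    (turn v ≠ a → Reach turn T a s (v ++ [b]) → Reach turn T a s (v ++ [!b]))

/-- The moves of optimal strategies for both agents. -/
def Allowed (turn : List Bool → Player) (R : ℕ → ℕ → List Bool → Prop) :
    ℕ → Player → List Bool → Bool → Prop
  | 0, _, _, _ => True
  | m + 1, a, v, b =>
    ((m ≠ 0 ∧ ∃ s, R m s v) → Allowed turn R m (1 - a) v b) ∧
    (¬ (m ≠ 0 ∧ ∃ s, R m s v) →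
      ∀ s, NoWorse turn (Target R m (Att turn R m (1 - a))) a v b s)

/-- The difference sets of the open sets that are enumerated by `R`. -/
def DiffOf (R : ℕ → ℕ → List Bool → Prop) : ℕ → Set Cantor
  | 0 => ∅
  | m + 1 => {x | (∃ k s, R m s (pre x k)) ∧ x ∉ DiffOf R m}

section Values

variable {turn : List Bool → Player} {R : ℕ → ℕ → List Bool → Prop}

theorem IsForcing.mono {T T' : List Bool → Prop} (hT : ∀ w, T w → T' w) {a : Player}
    {L : List (List Bool)} (h : IsForcing turn T a L) : IsForcing turn T' a L :=
  fun w hw => (h w hw).imp_left (hT w)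

theorem Reach.mono {T : ℕ → List Bool → Prop} (hT : StageMono T)
    {a : Player} {s t : ℕ} (hst : s ≤ t) {v : List Bool} (h : Reach turn T a s v) :
    Reach turn T a t v := by
  obtain ⟨c, hc, L, hL, hv, hf⟩ := h
  exact ⟨c, hc.trans_le hst, L, hL, hv, hf.mono fun _ => hT hst⟩

/-- A finite forcing list is a witness at all late enough stages. -/
theorem Reach.of_isForcing {T : ℕ → List Bool → Prop} (hT : StageMono T)
    {a : Player} {s : ℕ} {v : List Bool} {L : List (List Bool)} (hv : v ∈ L)
    (h : IsForcing turn (T s) a L) : ∃ t, Reach turn T a t v :=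
  ⟨max s (encode L + 1), encode L, by omega, L, encodek L, hv,
    h.mono fun _ => hT (le_max_left _ _)⟩

/-- A forcing list for `v` consists of `v` and a list for one successor, or `v` and the lists for
both. In the other direction the list also serves the successors of `v`, unless `v` is itself a
target; `hstep` covers that case. -/
theorem Reach.exists_iff {T : ℕ → List Bool → Prop} (hT : StageMono T)
    (hstep : ∀ {s w}, T s w → (turn w = a → ∃ b, T s (w ++ [b])) ∧
      (turn w ≠ a → ∀ b, T s (w ++ [b])))
    {v : List Bool} :
    (∃ s, Reach turn T a s v) ↔
      (turn v = a → ∃ b s, Reach turn T a s (v ++ [b])) ∧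
      (turn v ≠ a → ∀ b, ∃ s, Reach turn T a s (v ++ [b])) := by
  have single : ∀ {s w}, T s w → ∃ t, Reach turn T a t w := fun {s w} h =>
    Reach.of_isForcing (L := [w]) hT (by simp) fun u hu => by
      obtain rfl := List.mem_singleton.1 hu; exact Or.inl h
  constructor
  · rintro ⟨s, c, hc, L, hL, hv, hf⟩
    have hmem : ∀ w ∈ L, ∃ s, Reach turn T a s w := fun w hw => ⟨s, c, hc, L, hL, hw, hf⟩
    rcases hf v hv with h | ⟨ht, b, hb⟩ | ⟨ht, hb⟩
    · exact ⟨fun ht => ((hstep h).1 ht).imp fun b hb => single hb,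
        fun ht b => single ((hstep h).2 ht b)⟩
    · exact ⟨fun _ => ⟨b, hmem _ hb⟩, fun h => absurd ht h⟩
    · exact ⟨fun h => absurd h ht, fun _ b => hmem _ (hb b)⟩
  · rintro ⟨h₁, h₂⟩
    by_cases ht : turn v = a
    · obtain ⟨b, s, c, hc, L, hL, hv, hf⟩ := h₁ ht
      refine Reach.of_isForcing (s := s) (L := v :: L) hT (by simp) fun w hw => ?_
      rcases List.mem_cons.1 hw with rfl | hw
      · exact Or.inr (Or.inl ⟨ht, b, List.mem_cons_of_mem _ hv⟩)
      · rcases hf w hw with h | ⟨h, b, hb⟩ | ⟨h, hb⟩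
        · exact Or.inl h
        · exact Or.inr (Or.inl ⟨h, b, List.mem_cons_of_mem _ hb⟩)
        · exact Or.inr (Or.inr ⟨h, fun b => List.mem_cons_of_mem _ (hb b)⟩)
    · choose s c hc L hL hv hf using h₂ ht
      have hsub : ∀ b w, w ∈ L b → w ∈ v :: (L false ++ L true) := by
        intro b w hw
        cases b <;> simp [hw]
      refine Reach.of_isForcing (s := max (s false) (s true)) (L := v :: (L false ++ L true)) hT
        (by simp) fun w hw => ?_
      have key : ∀ b, w ∈ L b → T (max (s false) (s true)) w ∨
          (turn w = a ∧ ∃ b, w ++ [b] ∈ v :: (L false ++ L true)) ∨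
          (turn w ≠ a ∧ ∀ b, w ++ [b] ∈ v :: (L false ++ L true)) := by
        intro b hw
        rcases hf b w hw with h | ⟨h, b', hb⟩ | ⟨h, hb⟩
        · exact Or.inl (hT (by cases b <;> simp) h)
        · exact Or.inr (Or.inl ⟨h, b', hsub b _ hb⟩)
        · exact Or.inr (Or.inr ⟨h, fun b' => hsub b _ (hb b')⟩)
      rcases List.mem_cons.1 hw with rfl | hw
      · exact Or.inr (Or.inr ⟨ht, fun b => hsub b _ (hv b)⟩)
      · rcases List.mem_append.1 hw with hw | hw
        · exact key false hw
        · exact key true hw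

/-- If both moves failed, each successor would be reached at a stage when its sibling is not. By
monotonicity this is impossible at the later of the two stages. -/
theorem NoWorse.exists {T : ℕ → List Bool → Prop} (hT : StageMono T)
    (a : Player) (v : List Bool) : ∃ b, ∀ s, NoWorse turn T a v b s := by
  by_contra hcon
  push Not at hcon
  obtain ⟨s, hs⟩ := hcon false
  obtain ⟨t, ht⟩ := hcon true
  simp only [NoWorse, Bool.not_false, Bool.not_true] at hs ht
  rcases le_total s t with hst | hst <;>
  · have h₁ := fun w => Reach.mono (turn := turn) (T := T) (v := w) hT (a := a) hst
    have h₂ := h₁ (v ++ [true])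
    have h₃ := h₁ (v ++ [false])
    tauto

variable (hR : IsRecognition R)

include hR in
theorem Target.mono (m : ℕ) (W : List Bool → Prop) : StageMono (Target R m W) :=
  fun _ _ _ hst h => ⟨hR.mono m hst h.1, h.2⟩

include hR in
theorem Allowed.exists (m : ℕ) (a : Player) (v : List Bool) : ∃ b, Allowed turn R m a v b := by
  induction m generalizing a with
  | zero => exact ⟨true, trivial⟩
  | succ m IH =>
    by_cases h : m ≠ 0 ∧ ∃ s, R m s v
    · obtain ⟨b, hb⟩ := IH (1 - a)
      exact ⟨b, fun _ => hb, fun h' => absurd h h'⟩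
    · obtain ⟨b, hb⟩ := NoWorse.exists (turn := turn)
        (T := Target R m (Att turn R m (1 - a))) (Target.mono hR _ _) a v
      exact ⟨b, fun h' => absurd h' h, fun _ => hb⟩

include hR in
-- Induction on the level: the step equivalence for the opponent one level below shows that targets
-- persist at some successor when `a` moves, and at all successors otherwise.
theorem Att.iff_step (m : ℕ) (a : Player) (v : List Bool) :
    Att turn R m a v ↔ (turn v = a → ∃ b, Att turn R m a (v ++ [b])) ∧
      (turn v ≠ a → ∀ b, Att turn R m a (v ++ [b])) := by
  induction m generalizing a v with
  | zero =>
    simp only [Att]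
    tauto
  | succ m IH =>
    refine Reach.exists_iff (Target.mono hR _ _) ?_
    rintro s w ⟨hRw, hW⟩
    rw [IH, Player.eq_swap_iff] at hW
    refine ⟨fun ht => ?_, fun ht b => ⟨hR.concat b hRw, ?_⟩⟩
    · have : ¬ ∀ b, Att turn R m (1 - a) (w ++ [b]) := by
        simp only [ne_eq, Player.eq_swap_iff, ht] at hW
        tauto
      push Not at this
      obtain ⟨b, hb⟩ := this
      exact ⟨b, hR.concat b hRw, hb⟩
    · intro hb
      refine hW ⟨fun _ => ⟨b, hb⟩, fun h => absurd (Player.eq_swap_iff.2 ht) h⟩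

include hR in
/-- At a position known to lie in one of the open sets, the attacker of a level wins iff he wins
as the defender of the level below. -/
theorem Att.succ_iff {m : ℕ} {a : Player} {s : ℕ} {v : List Bool} (hv : R m s v) :
    Att turn R (m + 1) a v ↔ ¬ Att turn R m (1 - a) v := by
  constructor
  · rintro ⟨t, c, hc, L, hL, hvL, hf⟩
    -- The words of the finite list have bounded length, so an induction on the remaining length
    -- ends at targets, where the claim is the definition; it is carried back by `Att.iff_step`.
    obtain ⟨N, hN⟩ : ∃ N, ∀ w ∈ L, w.length ≤ N := by
      refine ⟨(L.map List.length).sum, fun w hw => ?_⟩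
      exact List.single_le_sum (by simp) _ (List.mem_map_of_mem hw)
    clear hL
    obtain ⟨d, hd⟩ : ∃ d, d + v.length = N + 1 := ⟨N + 1 - v.length, by have := hN v hvL; omega⟩
    induction d generalizing v with
    | zero => have := hN v hvL; omega
    | succ d IH =>
      have IH' : ∀ b, v ++ [b] ∈ L → ¬ Att turn R m (1 - a) (v ++ [b]) := fun b hb =>
        IH (hR.concat b hv) hb (by simp; omega)
      rcases hf v hvL with h | ⟨h, b, hb⟩ | ⟨h, hb⟩
      · exact h.2
      · rw [Att.iff_step hR]
        intro hA
        refine IH' b hb (hA.2 ?_ b)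
        rw [ne_eq, Player.eq_swap_iff]
        simpa using h
      · rw [Att.iff_step hR]
        intro hA
        obtain ⟨b, hA⟩ := hA.1 (Player.eq_swap_iff.2 h)
        exact IH' b (hb b) hA
  · intro h
    refine Reach.of_isForcing (s := s) (L := [v]) (Target.mono hR _ _) (by simp) fun w hw => ?_
    obtain rfl := List.mem_singleton.1 hw
    exact Or.inl ⟨hv, h⟩

include hR in
theorem R_pre_mono {m s j k : ℕ} {x : Cantor} (hjk : j ≤ k) (h : R m s (pre x j)) :
    R m s (pre x k) := by
  induction k, hjk using Nat.le_induction with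
  | base => exact h
  | succ k _ IH => rw [pre_succ]; exact hR.concat _ IH

theorem Allowed.of_known {m s : ℕ} {a : Player} {v : List Bool} {b : Bool} (hv : R m s v)
    (h : Allowed turn R (m + 1) a v b) : Allowed turn R m (1 - a) v b := by
  rcases Nat.eq_zero_or_pos m with rfl | hm
  · trivial
  · exact h.1 ⟨hm.ne', s, hv⟩

theorem Allowed.of_unknown {m : ℕ} {a : Player} {v : List Bool} {b : Bool}
    (hv : ∀ s, ¬ R m s v) (h : Allowed turn R (m + 1) a v b) (s : ℕ) :
    NoWorse turn (Target R m (Att turn R m (1 - a))) a v b s :=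
  h.2 (fun h' => h'.2.elim fun s hs => hv s hs) s

/-- Playing allowed moves, the attacker reaches a known position that is winning for him. -/
theorem Att.exists_known {m : ℕ} {a : Player} {x : Cantor} {j : ℕ}
    (hA : Att turn R (m + 1) a (pre x j))
    (hx : ∀ k ≥ j, turn (pre x k) = a → Allowed turn R (m + 1) a (pre x k) (x k)) :
    ∃ k ≥ j, (∃ s, R m s (pre x k)) ∧ Att turn R (m + 1) a (pre x k) := by
  by_contra hcon
  push Not at hcon
  have hunk : ∀ k ≥ j, Att turn R (m + 1) a (pre x k) → ∀ s, ¬ R m s (pre x k) :=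
    fun k hk hA s hRs => hcon k hk ⟨s, hRs⟩ hA
  obtain ⟨s, hsA⟩ := hA
  -- The stage `s` stays fixed along the play: a move to a successor reached at stage `s` exists,
  -- and an allowed move is no worse.
  have hall : ∀ k ≥ j, Reach turn (Target R m (Att turn R m (1 - a))) a s (pre x k) := by
    intro k hk
    induction k, hk using Nat.le_induction with
    | base => exact hsA
    | succ k hk IH =>
      have hno := hunk k hk ⟨s, IH⟩
      obtain ⟨c, hc, L, hL, hv, hf⟩ := id IH
      have hmem : ∀ b, pre x k ++ [b] ∈ L → Reach turn
          (Target R m (Att turn R m (1 - a))) a s (pre x k ++ [b]) :=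
        fun b hb => ⟨c, hc, L, hL, hb, hf⟩
      rw [pre_succ]
      rcases hf _ hv with h | ⟨h, b, hb⟩ | ⟨h, hb⟩
      · exact absurd h.1 (hno s)
      · have := (Allowed.of_unknown hno (hx k hk h) s).1 h
        rcases Bool.eq_or_eq_not b (x k) with rfl | rfl
        · exact hmem _ hb
        · exact this (hmem _ hb)
      · exact hmem _ (hb _)
  -- Finitely many lists have a code below `s`, so their words cannot contain arbitrarily long
  -- prefixes of the play.
  have hbound : ∃ N, ∀ c < s, ∀ L, decode (α := List (List Bool)) c = some L →
      ∀ w ∈ L, w.length ≤ N := by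
    clear hsA hall
    induction s with
    | zero => exact ⟨0, by simp⟩
    | succ s IH =>
      obtain ⟨N, hN⟩ := IH
      refine ⟨N + (((decode (α := List (List Bool)) s).getD []).map List.length).sum, ?_⟩
      intro c hc L hL w hw
      rcases Nat.lt_succ_iff_lt_or_eq.1 hc with hc | rfl
      · exact (hN c hc L hL w hw).trans (Nat.le_add_right _ _)
      · rw [hL]
        exact (List.single_le_sum (by simp) _ (List.mem_map_of_mem hw)).trans
          (Nat.le_add_left _ _)
  obtain ⟨N, hN⟩ := hbound
  obtain ⟨c, hc, L, hL, hv, -⟩ := hall (j + N + 1) (by omega)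
  have := hN c hc L hL _ hv
  rw [length_pre] at this
  omega

include hR in
/-- Playing allowed moves, the defender stays in the positions that are winning for him as long as
the position is not known to lie in one of the open sets. -/
theorem Att.not_of_unknown {m : ℕ} {a : Player} {x : Cantor} {j : ℕ}
    (hA : ¬ Att turn R (m + 1) a (pre x j))
    (hx : ∀ k ≥ j, turn (pre x k) = 1 - a → Allowed turn R (m + 1) a (pre x k) (x k))
    {k : ℕ} (hk : j ≤ k) (hun : ∀ i < k, ∀ s, ¬ R m s (pre x i)) :
    ¬ Att turn R (m + 1) a (pre x k) := by
  induction k, hk using Nat.le_induction with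
  | base => exact hA
  | succ k hk IH =>
    have IH := IH fun i hi => hun i (by omega)
    have hno := hun k (by omega)
    rw [pre_succ]
    intro hcon
    refine IH ((Att.iff_step hR _ _ _).2 ⟨fun _ => ⟨_, hcon⟩, fun h b => ?_⟩)
    obtain ⟨s, hs'⟩ := hcon
    have := (Allowed.of_unknown hno (hx k hk (Player.eq_swap_iff.2 h)) s).2 h hs'
    rcases Bool.eq_or_eq_not b (x k) with rfl | rfl
    · exact ⟨s, hs'⟩
    · exact ⟨s, this⟩

include hR in
/-- Allowed moves are optimal for the attacker and for the defender. -/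
theorem Allowed.optimal (m : ℕ) (a : Player) (x : Cantor) (j : ℕ) :
    (Att turn R m a (pre x j) →
      (∀ k ≥ j, turn (pre x k) = a → Allowed turn R m a (pre x k) (x k)) → x ∈ DiffOf R m) ∧
    (¬ Att turn R m a (pre x j) →
      (∀ k ≥ j, turn (pre x k) = 1 - a → Allowed turn R m a (pre x k) (x k)) →
        x ∉ DiffOf R m) := by
  induction m generalizing a j with
  | zero => exact ⟨fun h => h.elim, fun _ _ h => h⟩
  | succ m IH =>
    have hdown : ∀ {k s}, R m s (pre x k) → ∀ c,
        (∀ i ≥ k, turn (pre x i) = c → Allowed turn R (m + 1) a (pre x i) (x i)) →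
        ∀ i ≥ k, turn (pre x i) = c → Allowed turn R m (1 - a) (pre x i) (x i) :=
      fun hRs c h i hi ht => Allowed.of_known (R_pre_mono hR hi hRs) (h i hi ht)
    constructor
    · intro hA hx
      obtain ⟨k, hk, ⟨s, hRs⟩, hA⟩ := Att.exists_known hA hx
      refine ⟨⟨k, s, hRs⟩, (IH (1 - a) k).2 ((Att.succ_iff hR hRs).1 hA) ?_⟩
      rw [Player.swap_swap]
      exact hdown hRs a fun i hi => hx i (hk.le.trans hi)
    · rintro hA hx ⟨hex, hxD⟩
      have hex' : ∃ k, j ≤ k ∧ ∃ s, R m s (pre x k) := by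
        obtain ⟨k, s, hRs⟩ := hex
        exact ⟨max j k, le_max_left _ _, s, R_pre_mono hR (le_max_right _ _) hRs⟩
      classical
      have hfind := Nat.find_spec hex'
      obtain ⟨hjk, s, hRs⟩ := hfind
      -- Either no position before the one found is known, and the defender is still safe there, or
      -- a position before `j` is known, and then so is `j`.
      have hstart : ∃ k ≥ j, (∃ s, R m s (pre x k)) ∧ ¬ Att turn R (m + 1) a (pre x k) := by
        by_cases hall : ∀ i < Nat.find hex', ∀ s, ¬ R m s (pre x i)
        · exact ⟨_, hjk, ⟨s, hRs⟩, Att.not_of_unknown hR hA hx hjk hall⟩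
        · push Not at hall
          obtain ⟨i, hi, s, hRs⟩ := hall
          have hij : i < j := by
            by_contra hij
            exact Nat.find_min hex' hi ⟨by omega, s, hRs⟩
          exact ⟨j, le_rfl, ⟨s, R_pre_mono hR hij.le hRs⟩, hA⟩
      obtain ⟨k, hk, ⟨s, hRs⟩, hA⟩ := hstart
      rw [Att.succ_iff hR hRs, not_not] at hA
      exact hxD ((IH (1 - a) k).1 hA (hdown hRs (1 - a) fun i hi => hx i (hk.le.trans hi)))

end Values

end WeihrauchGames

/-! ### Upper bounds: complexity of optimal profiles and of the winner. -/

namespace WeihrauchGames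

open Encodable Filter

/-! ## Difference sets -/

section DiffSet

variable {m : ℕ} {U : ℕ → Set Cantor} {x : Cantor}

theorem mem_diffSet_of_mem {i : ℕ} (hi : i < m) (hx : x ∈ U i) (hmin : ∀ k < i, x ∉ U k) :
    x ∈ diffSet (fun k : Fin m => U k) ↔ i % 2 ≠ m % 2 := by
  have h : sInf (insert m {β : ℕ | ∃ k : Fin m, (k : ℕ) = β ∧ x ∈ U k}) = i := by
    refine IsLeast.csInf_eq ⟨Or.inr ⟨⟨i, hi⟩, rfl, hx⟩, ?_⟩
    rintro _ (rfl | ⟨k, rfl, hk⟩)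
    · exact hi.le
    · by_contra hlt
      exact hmin k (by omega) hk
  show _ % 2 ≠ m % 2 ↔ _
  rw [h]

theorem notMem_diffSet (hx : ∀ k < m, x ∉ U k) : x ∉ diffSet (fun k : Fin m => U k) := by
  have h : sInf (insert m {β : ℕ | ∃ k : Fin m, (k : ℕ) = β ∧ x ∈ U k}) = m := by
    refine IsLeast.csInf_eq ⟨Or.inl rfl, ?_⟩
    rintro _ (rfl | ⟨k, rfl, hk⟩)
    · exact le_rfl
    · exact absurd hk (hx k k.2)
  show ¬ _ % 2 ≠ m % 2
  rw [h]
  simp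

/-- Passing from m to m+1 flips the parity of the level, hence membership, for points whose least
index is below m. Points with least index m enter, and points in none of the sets stay outside. -/
theorem mem_diffSet_succ : x ∈ diffSet (fun k : Fin (m + 1) => U k) ↔
    (∃ i < m + 1, x ∈ U i) ∧ x ∉ diffSet (fun k : Fin m => U k) := by
  by_cases hex : ∃ i < m + 1, x ∈ U i
  · classical
    obtain ⟨hi, hx⟩ := Nat.find_spec hex
    have hmin : ∀ k < Nat.find hex, x ∉ U k := fun k hk hxk =>
      Nat.find_min hex hk ⟨hk.trans hi, hxk⟩
    rw [mem_diffSet_of_mem hi hx hmin]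
    rcases Nat.lt_succ_iff_lt_or_eq.1 hi with hi | hi
    · rw [mem_diffSet_of_mem hi hx hmin]
      constructor
      · exact fun h => ⟨hex, by omega⟩
      · rintro ⟨-, h⟩
        omega
    · rw [hi] at hmin ⊢
      exact ⟨fun _ => ⟨hex, notMem_diffSet hmin⟩, fun _ => by omega⟩
  · refine ⟨fun h => absurd h (notMem_diffSet fun k hk hxk => hex ⟨k, hk, hxk⟩),
      fun h => absurd h.1 hex⟩

theorem DiffOf_eq_diffSet {R : ℕ → ℕ → List Bool → Prop}
    (hR : ∀ m x, (∃ k s, R m s (pre x k)) ↔ ∃ i < m + 1, x ∈ U i) (m : ℕ) :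
    DiffOf R m = diffSet (fun k : Fin m => U k) := by
  induction m with
  | zero =>
    ext x
    exact ⟨fun h => h.elim, fun h => absurd h (notMem_diffSet (by simp))⟩
  | succ m IH =>
    ext x
    rw [mem_diffSet_succ, ← hR, ← IH]
    rfl

end DiffSet

/-! ## Winning profiles -/

@[simp] theorem playPrefix_eq_pre (σ : List Bool → Bool) (n : ℕ) :
    playPrefix σ n = pre (play σ) n := by
  induction n with
  | zero => rfl
  | succ n IH =>
    rw [pre_succ, ← IH]
    rfl

theorem play_apply (σ : List Bool → Bool) (n : ℕ) : play σ n = σ (pre (play σ) n) := by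
  rw [← playPrefix_eq_pre]
  rfl

/-- The choices of `a` in the profile `σ` form a winning strategy. -/
def IsWinningFor (G : SeqGame Player Bool Player) (σ : List Bool → Bool) (a : Player) : Prop :=
  ∀ τ : List Bool → Bool, (∀ h, G.turn h = a → τ h = σ h) → G.val (play τ) = a

theorem IsWinningFor.isNash {turn : List Bool → Player} {W : Set Cantor} {σ : List Bool → Bool}
    {a : Player} (h : IsWinningFor (winLose turn W) σ a) : (winLose turn W).IsNash σ := by
  rintro c τ hτ ⟨h₁, h₂⟩
  by_cases hca : c = a
  · subst hca
    exact h₁ (h σ fun _ _ => rfl)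
  · rw [h τ fun v hv => hτ v (by rw [hv]; exact Ne.symm hca)] at h₂
    exact hca h₂.symm

section Optimal

variable {turn : List Bool → Player} {R : ℕ → ℕ → List Bool → Prop}

/-- The agent who can force a win from the initial position. -/
noncomputable def attWinner (turn : List Bool → Player) (R : ℕ → ℕ → List Bool → Prop) (m : ℕ) :
    Player :=
  open Classical in if Att turn R m 0 [] then 0 else 1

theorem isWinningFor_of_allowed (hR : IsRecognition R) {m : ℕ} {σ : List Bool → Bool}
    (hσ : ∀ v, Allowed turn R m 0 v (σ v)) :
    IsWinningFor (winLose turn (DiffOf R m)) σ (attWinner turn R m) := by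
  intro τ hτ
  have hopt := Allowed.optimal (turn := turn) hR m 0 (play τ) 0
  have hall : ∀ k ≥ 0, turn (pre (play τ) k) = attWinner turn R m →
      Allowed turn R m 0 (pre (play τ) k) (play τ k) := fun k _ hk => by
    rw [play_apply, hτ _ hk]
    exact hσ _
  unfold attWinner at hall ⊢
  split_ifs at hall ⊢ with h
  · simp [winLose, hopt.1 h hall]
  · simp [winLose, hopt.2 h hall]

end Optimal

/-! ## The game given by a name -/

/-- The turn function given by the name `p` of a game. -/
def turnOf (p : Baire) (v : List Bool) : Player := if p (2 * encode v) = 0 then 0 else 1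

/-- A cylinder around `v` is listed up to entry `s` in one of the first `m + 1` open sets given by
the name `p` of a game. -/
def Known (p : Baire) (m s : ℕ) (v : List Bool) : Prop :=
  ∃ i < m + 1, ∃ j < s, ∃ k < v.length + 1, p (2 * Nat.pair i j + 1) = encode (v.take k) + 1

theorem isRecognition_known (p : Baire) : IsRecognition (Known p) where
  mono m s t w hst := by
    rintro ⟨i, hi, j, hj, h⟩
    exact ⟨i, hi, j, hj.trans_le hst, h⟩
  concat := by
    rintro m s w b ⟨i, hi, j, hj, k, hk, h⟩
    refine ⟨i, hi, j, hj, k, by simp; omega, ?_⟩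
    rw [h, List.take_append_of_le_length (by omega)]

/-- The open sets given by the name `p` of a game. -/
def openSeq (p : Baire) (i : ℕ) : Set Cantor := openOf fun k => p (2 * Nat.pair i k + 1)

theorem exists_known_iff (p : Baire) (m : ℕ) (x : Cantor) :
    (∃ k s, Known p m s (pre x k)) ↔ ∃ i < m + 1, x ∈ openSeq p i := by
  constructor
  · rintro ⟨k, s, i, hi, j, hj, l, hl, h⟩
    rw [pre_take _ (by simpa using Nat.lt_succ_iff.1 hl)] at h
    exact ⟨i, hi, j, l, h⟩
  · rintro ⟨i, hi, j, l, h⟩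
    exact ⟨l, j + 1, i, hi, j, by omega, l, by simp, by rw [pre_take _ le_rfl]; exact h⟩

theorem game_of_names {n : ℕ} {p : Baire} {g : (List Bool → Player) × (diffClass n).sets}
    (h : (Det (diffClass n)).δX.names p g) :
    g.1 = turnOf p ∧ (g.2 : Set Cantor) = DiffOf (Known p) n := by
  obtain ⟨h₁, h₂⟩ := h
  refine ⟨funext fun v => ?_, ?_⟩
  · have := h₁ v
    dsimp only at this
    unfold turnOf
    rw [this]
    generalize g.1 v = a
    revert a
    decide
  · rw [DiffOf_eq_diffSet (exists_known_iff p)]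
    exact h₂

/-! ## Complexity of the optimal moves -/

section Complexity

theorem limDec_turnOf {n : ℕ} (a : Player) : LimDec n fun p v => turnOf p v = a := by
  have h : LimUse n fun p (v : List Bool) => p (2 * encode v) :=
    LimUse.of_boundedUse (BoundedUse.oracle.comp (Primrec.nat_double.comp Primrec.encode))
  have h0 := LimDec.eq h (LimUse.of_primrec (Primrec.const 0))
  by_cases ha : a = 0
  · exact h0.of_iff fun p v => by simp [turnOf, ha]
  · obtain rfl : a = 1 := by revert a; decide
    exact h0.not.of_iff fun p v => by simp [turnOf]

theorem limDec_known {n : ℕ} (m : ℕ) :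
    LimDec n fun p (z : ℕ × List Bool) => Known p m z.1 z.2 := by
  have hv : Primrec fun z : (((ℕ × List Bool) × ℕ) × ℕ) × ℕ => z.1.1.1.2 :=
    Primrec.snd.comp (Primrec.fst.comp (Primrec.fst.comp Primrec.fst))
  have ho : LimUse n fun p (z : (((ℕ × List Bool) × ℕ) × ℕ) × ℕ) =>
      p (2 * Nat.pair z.1.1.2 z.1.2 + 1) :=
    LimUse.of_boundedUse (BoundedUse.oracle.comp (Primrec.nat_double_succ.comp
      (Primrec₂.natPair.comp (Primrec.snd.comp (Primrec.fst.comp Primrec.fst))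
        (Primrec.snd.comp Primrec.fst))))
  have he := LimDec.eq ho (LimUse.of_primrec (n := n) (Primrec.succ.comp
    (Primrec.encode.comp (Primrec.list_take.comp Primrec.snd hv))))
  have h := ((he.exists_lt (u := fun z => z.1.1.2.length + 1)
    (Primrec.succ.comp (Primrec.list_length.comp (Primrec.snd.comp
      (Primrec.fst.comp Primrec.fst))))).exists_lt (u := fun z => z.1.1)
    (Primrec.fst.comp Primrec.fst)).exists_lt (u := fun _ => m + 1) (Primrec.const _)
  exact h.of_iff fun p z => Iff.rfl

theorem limDec_mem {α β : Type} [Primcodable α] [Primcodable β] {n : ℕ} {f : α → β}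
    {l : α → List β} (hf : Primrec f) (hl : Primrec l) :
    LimDec n fun (_ : Baire) a => f a ∈ l a := by
  have h : LimDec n fun (_ : Baire) (z : α × β) => z.2 = f z.1 :=
    LimDec.eq (LimUse.of_primrec Primrec.snd) (LimUse.of_primrec (hf.comp Primrec.fst))
  exact (h.exists_mem hl).of_iff fun p a => by simp

theorem limDec_reach {n : ℕ} {turn : Baire → List Bool → Player} {a : Player}
    (hturn : LimDec n fun p v => turn p v = a) {T : Baire → ℕ → List Bool → Prop}
    (hT : LimDec n fun p (z : ℕ × List Bool) => T p z.1 z.2) :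
    LimDec n fun p (z : ℕ × List Bool) => Reach (turn p) (T p) a z.1 z.2 := by
  let α := ((ℕ × List Bool) × ℕ) × List (List Bool)
  have hL : Primrec fun z : α => z.2 := Primrec.snd
  have hs : Primrec fun z : α => z.1.1.1 :=
    Primrec.fst.comp (Primrec.fst.comp Primrec.fst)
  have hv : Primrec fun z : α => z.1.1.2 :=
    Primrec.snd.comp (Primrec.fst.comp Primrec.fst)
  have hchild : LimDec n fun (_ : Baire) (z : (α × List Bool) × Bool) =>
      z.1.2 ++ [z.2] ∈ z.1.1.2 :=
    limDec_mem (Primrec.list_concat.comp (Primrec.snd.comp Primrec.fst) Primrec.snd)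
      (hL.comp (Primrec.fst.comp Primrec.fst))
  have hbool : Primrec fun _ : α × List Bool => [false, true] := Primrec.const _
  have hturn := hturn.comp (α := α × List Bool) Primrec.snd
  have hT' := hT.comp (α := α × List Bool) (Primrec.pair (hs.comp Primrec.fst) Primrec.snd)
  have hforce := (hT'.or ((hturn.and (hchild.exists_mem hbool)).or
    (hturn.not.and (hchild.forall_mem hbool)))).forall_mem hL
  have hin := (limDec_mem (n := n) hv hL).and hforce
  have hdec : Primrec fun z : (ℕ × List Bool) × ℕ =>
      (decode (α := List (List Bool)) z.2).toList :=
    Primrec.optionToList.comp (Primrec.decode.comp Primrec.snd)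
  refine ((hin.exists_mem hdec).exists_lt (u := Prod.fst) Primrec.fst).of_iff fun p z => ?_
  simp [Reach, IsForcing]

theorem limDec_target {n : ℕ} (m : ℕ) {R : Baire → ℕ → ℕ → List Bool → Prop}
    (hR : LimDec n fun p (z : ℕ × List Bool) => R p m z.1 z.2) {W : Baire → List Bool → Prop}
    (hW : LimDec n W) :
    LimDec n fun p (z : ℕ × List Bool) => Target (R p) m (W p) z.1 z.2 :=
  hR.and (hW.comp Primrec.snd).not

theorem limDec_att (m : ℕ) (a : Player) :
    LimDec m fun p v => Att (turnOf p) (Known p) m a v := by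
  induction m generalizing a with
  | zero => exact LimDec.const False
  | succ m IH =>
    exact ((limDec_reach (limDec_turnOf a)
      (limDec_target m (limDec_known m) (IH (1 - a)))).comp
      (Primrec.pair Primrec.snd Primrec.fst)).exists_nat

/-- The predicate that decides at stage `s` that `b` is an allowed move at `v`. -/
def AllowedAt (turn : List Bool → Player) (R : ℕ → ℕ → List Bool → Prop) (m : ℕ) (a : Player)
    (v : List Bool) (b : Bool) (s : ℕ) : Prop :=
  ((m ≠ 0 ∧ ∃ s, R m s v) → Allowed turn R m (1 - a) v b) ∧
    (¬ (m ≠ 0 ∧ ∃ s, R m s v) → NoWorse turn (Target R m (Att turn R m (1 - a))) a v b s)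

theorem allowed_succ_iff {turn : List Bool → Player} {R : ℕ → ℕ → List Bool → Prop} {m : ℕ}
    {a : Player} {v : List Bool} {b : Bool} :
    Allowed turn R (m + 1) a v b ↔ ∀ s, AllowedAt turn R m a v b s :=
  ⟨fun h s => ⟨h.1, fun h' => h.2 h' s⟩, fun h => ⟨(h 0).1, fun h' s => (h s).2 h'⟩⟩

/-- With the stage fixed, only `m` limits are needed. The stage quantifier in `Allowed` at level `m
+ 1` becomes the one inherent in naming a closed set. -/
theorem limDec_allowedAt_of_allowed {m : ℕ} {a : Player}
    (h : LimDec m fun p (z : List Bool × Bool) =>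
      Allowed (turnOf p) (Known p) m (1 - a) z.1 z.2) :
    LimDec m fun p (z : (List Bool × Bool) × ℕ) =>
      AllowedAt (turnOf p) (Known p) m a z.1.1 z.1.2 z.2 := by
  -- The unbounded search in the guard needs one limit, which is unavailable when `m = 0`. This is
  -- why the guard contains `m ≠ 0`; nothing is lost, as every move is allowed at level 0.
  have hguard : LimDec m fun p (v : List Bool) => m ≠ 0 ∧ ∃ s, Known p m s v := by
    cases m with
    | zero => exact (LimDec.const False).of_iff fun p v => by simp
    | succ m =>
      exact ((limDec_known (m + 1)).comp (Primrec.pair Primrec.snd Primrec.fst)).exists_nat.of_iff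
        fun p v => by simp
  have hv : Primrec fun z : (List Bool × Bool) × ℕ => z.1.1 := Primrec.fst.comp Primrec.fst
  have hb : Primrec fun z : (List Bool × Bool) × ℕ => z.1.2 := Primrec.snd.comp Primrec.fst
  have hg := hguard.comp hv
  have hreach := limDec_reach (limDec_turnOf a)
    (limDec_target m (limDec_known m) (limDec_att m (1 - a)))
  have h₁ := hreach.comp (f := fun z : (List Bool × Bool) × ℕ => (z.2, z.1.1 ++ [z.1.2]))
    (Primrec.pair Primrec.snd (Primrec.list_concat.comp hv hb))
  have h₂ := hreach.comp (f := fun z : (List Bool × Bool) × ℕ => (z.2, z.1.1 ++ [!z.1.2]))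
    (Primrec.pair Primrec.snd (Primrec.list_concat.comp hv (Primrec.not.comp hb)))
  have ht := (limDec_turnOf (n := m) a).comp hv
  exact (hg.imp (h.comp Primrec.fst)).and
    (hg.not.imp ((ht.imp (h₂.imp h₁)).and (ht.not.imp (h₁.imp h₂))))

theorem limDec_allowed (m : ℕ) (a : Player) :
    LimDec m fun p (z : List Bool × Bool) => Allowed (turnOf p) (Known p) m a z.1 z.2 := by
  induction m generalizing a with
  | zero => exact LimDec.const True
  | succ m IH =>
    exact (limDec_allowedAt_of_allowed (IH (1 - a))).forall_nat.of_iff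
      fun p z => allowed_succ_iff

theorem limDec_allowedAt (m : ℕ) (a : Player) :
    LimDec m fun p (z : (List Bool × Bool) × ℕ) =>
      AllowedAt (turnOf p) (Known p) m a z.1.1 z.1.2 z.2 :=
  limDec_allowedAt_of_allowed (limDec_allowed m (1 - a))

end Complexity

/-! ## Closed sets of functions on words, and the upper bounds -/

/-- A `Π₁`-condition on the individual values of a function on words defines a closed set, a name
of which is computed uniformly. -/
theorem exists_closed_name {n : ℕ} {P : Baire → (List Bool × Bool) × ℕ → Prop}
    (hP : LimDec n P) : ∃ F : Baire → ℕ → ℕ, LimUse n F ∧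
      ∀ p x, x ∉ openOf (F p) ↔ ∀ v s, P p ((v, x (encode v)), s) := by
  have hw : Primrec fun z : (ℕ × List Bool) × List Bool => z.1.2 := Primrec.snd.comp Primrec.fst
  have hv : Primrec fun z : (ℕ × List Bool) × List Bool => z.2 := Primrec.snd
  have hlen : LimDec n fun (_ : Baire) (z : (ℕ × List Bool) × List Bool) =>
      z.1.2.length = encode z.2 + 1 :=
    LimDec.eq (LimUse.of_primrec (Primrec.list_length.comp hw))
      (LimUse.of_primrec (Primrec.succ.comp (Primrec.encode.comp hv)))
  have hP' := hP.not.comp (f := fun z : ((ℕ × List Bool) × List Bool) × Bool =>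
    ((z.1.2, z.2), z.1.1.1.unpair.2)) (Primrec.pair (Primrec.pair (Primrec.snd.comp Primrec.fst)
      Primrec.snd) (Primrec.snd.comp (Primrec.unpair.comp (Primrec.fst.comp (Primrec.fst.comp
        Primrec.fst)))))
  have hb : Primrec fun z : (ℕ × List Bool) × List Bool => (z.1.2[encode z.2]?).toList :=
    Primrec.optionToList.comp (Primrec.list_getElem?.comp hw (Primrec.encode.comp hv))
  have hdv : Primrec fun z : ℕ × List Bool =>
      (decode (α := List Bool) (z.2.length - 1)).toList :=
    Primrec.optionToList.comp (Primrec.decode.comp (Primrec.nat_sub.comp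
      (Primrec.list_length.comp Primrec.snd) (Primrec.const 1)))
  have hdw : Primrec fun z : ℕ => (decode (α := List Bool) z.unpair.1).toList :=
    Primrec.optionToList.comp (Primrec.decode.comp (Primrec.fst.comp Primrec.unpair))
  -- Entry `⟨w, s⟩` lists the word `w` iff its last bit, read as the value at the word `v` with code
  -- `w.length - 1`, violates `P` at stage `s`.
  obtain ⟨F, hF, h⟩ := ((hlen.and (hP'.exists_mem hb)).exists_mem hdv).exists_mem hdw
  have hq : LimUse n fun p j => bif F p j then j.unpair.1 + 1 else 0 :=
    hF.ite_bool (LimUse.of_primrec (Primrec.succ.comp (Primrec.fst.comp Primrec.unpair)))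
      (LimUse.of_primrec (Primrec.const 0))
  refine ⟨_, hq, fun p x => ?_⟩
  constructor
  · intro hx v s
    by_contra hcon
    refine hx ⟨Nat.pair (encode (pre x (encode v + 1))) s, encode v + 1, ?_⟩
    have : F p (Nat.pair (encode (pre x (encode v + 1))) s) = true := by
      rw [h]
      refine ⟨pre x (encode v + 1), by simp, v, by simp, by simp, x (encode v), ?_, by simpa⟩
      simp [pre]
    simp [this]
  · rintro hall ⟨j, k, hj⟩
    cases hFj : F p j with
    | false => simp [hFj] at hj
    | true =>
      simp only [hFj, cond_true, Nat.add_right_cancel_iff] at hj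
      obtain ⟨w, hw, v, -, hlen, b, hb, hcon⟩ := (h p j).1 hFj
      simp only [hj, encodek, Option.toList_some, List.mem_singleton] at hw
      subst hw
      dsimp only at hlen hb hcon
      simp only [length_pre] at hlen
      have hbx : b = x (encode v) := by
        have hlt : encode v < k := by omega
        simpa [pre, hlt] using hb
      subst hbx
      exact hcon (hall v _)

theorem WeihrauchLE.of_totalFunctional {f g : Problem} {K H : Baire → ℕ → ℕ}
    (hK : TotalFunctional K) (hH : TotalFunctional H)
    (h : ∀ p x, f.δX.names p x → (f.f x).Nonempty → ∃ x', g.δX.names (H p) x' ∧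
      (g.f x').Nonempty ∧ ∀ r, ∀ y ∈ g.f x', g.δY.names r y →
        ∃ z ∈ f.f x, f.δY.names (K (pairB p r)) z) : WeihrauchLE f g := by
  refine ⟨_, _, hK.computableOnBaire, hH.computableOnBaire, fun G hG p x hp hx => ?_⟩
  obtain ⟨x', hx', hne, hall⟩ := h p x hp hx
  obtain ⟨r, hr, y, hy, hry⟩ := hG _ _ hx' hne
  obtain ⟨z, hz, hz'⟩ := hall r y hy hry
  exact ⟨_, Part.mem_bind (Part.mem_some _) (Part.mem_bind hr (Part.mem_some _)), z, hz, hz'⟩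

theorem pairB_odd (p q : Baire) (k : ℕ) : pairB p q (2 * k + 1) = q k := by
  have h1 : (2 * k + 1) % 2 = 1 := by omega
  have h2 : (2 * k + 1) / 2 = k := by omega
  simp [pairB, h1, h2]

theorem TotalFunctional.second : TotalFunctional fun z k => z (2 * k + 1) :=
  oracle.comp (of_primrec Primrec.nat_double_succ)

theorem det_le_closedChoice (n : ℕ) :
    WeihrauchLE (Det (diffClass (n + 1))) (closedChoice.jump n) := by
  obtain ⟨F, hF, hFx⟩ := exists_closed_name (limDec_allowedAt n 0)
  obtain ⟨H, hH, hHF⟩ := hF.exists_isIterLim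
  -- A point of the closed set is already the look-up table of a profile, so the answer is copied
  -- unchanged.
  refine WeihrauchLE.of_totalFunctional .second hH.totalFunctional fun p g hp _ => ?_
  obtain ⟨hturn, hset⟩ := game_of_names hp
  let A : TopologicalSpace.Closeds Cantor :=
    ⟨(openOf (F p))ᶜ, (isOpen_openOf (F p)).isClosed_compl⟩
  have hmem : ∀ x : Cantor, x ∈ A ↔
      ∀ v, Allowed (turnOf p) (Known p) (n + 1) 0 v (x (encode v)) := fun x =>
    (hFx p x).trans (forall_congr' fun v => allowed_succ_iff.symm)
  refine ⟨A, (Representation.iterJump_names closedRep).2 ⟨F p, hHF p, rfl⟩, ?_, ?_⟩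
  · choose σ hσ using Allowed.exists (turn := turnOf p) (isRecognition_known p) (n + 1) 0
    refine ⟨fun k => ((decode (α := List Bool) k).map σ).getD true, (hmem _).2 fun v => ?_⟩
    simpa using hσ v
  · intro r (y : Cantor) hy hry
    refine ⟨fun v => y (encode v), ?_, fun v => ?_⟩
    · show (winLose g.1 g.2).IsNash _
      rw [hturn, hset]
      exact (isWinningFor_of_allowed (isRecognition_known p) ((hmem y).1 hy)).isNash
    · exact (pairB_odd p r (encode v)).trans (hry (encode v))

theorem win_le_lpo (n : ℕ) : WeihrauchLE (Win (diffClass (n + 1))) (LPO.jump n) := by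
  classical
  obtain ⟨F, hF, h⟩ := (limDec_reach (limDec_turnOf 0)
    (limDec_target n (limDec_known n) (limDec_att n (1 - 0)))).comp
    (Primrec.pair Primrec.id (Primrec.const ([] : List Bool)))
  -- This sequence is zero iff agent 0 cannot force a win. The answer `true` of `LPO` and the second
  -- player have the same code, so no translation is needed.
  have hq : LimUse n fun p s => bif F p s then 1 else 0 :=
    hF.ite_bool (LimUse.of_primrec (Primrec.const 1)) (LimUse.of_primrec (Primrec.const 0))
  obtain ⟨H, hH, hHF⟩ := hq.exists_isIterLim
  refine WeihrauchLE.of_totalFunctional .second hH.totalFunctional fun p g hp _ => ?_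
  obtain ⟨hturn, hset⟩ := game_of_names hp
  refine ⟨_, (Representation.iterJump_names baireRep).2 ⟨_, hHF p, rfl⟩, ⟨_, rfl⟩, ?_⟩
  intro r (y : Bool) hy (hry : r 0 = encode y)
  refine ⟨attWinner (turnOf p) (Known p) (n + 1), ?_, ?_⟩
  · show HasWinningStrategy (winLose g.1 g.2) _
    rw [hturn, hset]
    choose σ hσ using Allowed.exists (turn := turnOf p) (isRecognition_known p) (n + 1) 0
    exact ⟨σ, isWinningFor_of_allowed (isRecognition_known p) hσ⟩
  · show pairB p r (2 * 0 + 1) = encode (attWinner (turnOf p) (Known p) (n + 1))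
    rw [pairB_odd, hry, Set.mem_singleton_iff.1 hy]
    have hiff : Att (turnOf p) (Known p) (n + 1) 0 [] ↔ ∃ s, F p s = true :=
      exists_congr fun s => (h p s).symm
    unfold attWinner
    by_cases hex : ∃ s, F p s = true
    · rw [if_pos (hiff.2 hex), decide_eq_false]
      · rfl
      · obtain ⟨s, hs⟩ := hex
        intro h0
        simpa [hs] using congrFun h0 s
    · rw [if_neg fun h' => hex (hiff.1 h'), decide_eq_true]
      · rfl
      · funext s
        have : F p s = false := by
          rw [← Bool.not_eq_true]
          exact fun h' => hex ⟨s, h'⟩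
        simp [this]

end WeihrauchGames

/-! ### Lower bounds: picking games evaluate alternating quantifiers. -/

namespace WeihrauchGames

open Encodable Filter

/-! ## Picking games -/

/-- Agent `1` picks a single bit at the second turn; all other turns consist of picking a number in
unary. The state is the list of the completed picks, newest first, and the current count. -/
def pickStep (q : List ℕ × ℕ) (b : Bool) : List ℕ × ℕ :=
  if q.1.length = 1 then (b.toNat :: q.1, 0) else if b then (q.2 :: q.1, 0) else (q.1, q.2 + 1)

/-- The state of a picking game at the position `v`. -/
def picks (v : List Bool) : List ℕ × ℕ := v.foldl pickStep ([], 0)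

/-- The agents pick alternately. -/
def pickTurn (v : List Bool) : Player := if (picks v).1.length % 2 = 0 then 0 else 1

/-- The plays with `n + 3 - β` completed picks, which have to satisfy `Ψ` if `β = 0`. -/
def pickOpen (Ψ : List ℕ → Prop) (n β : ℕ) : Set Cantor :=
  {x | ∃ k, (picks (pre x k)).1.length + β = n + 3 ∧ (β = 0 → Ψ (picks (pre x k)).1)}

/-- The winning set of the first player in the picking game for `Ψ`. -/
def pickSet (Ψ : List ℕ → Prop) (n : ℕ) : Set Cantor :=
  diffSet fun β : Fin (n + 1) => pickOpen Ψ n β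

/-- The agent to move wins the picking game with `k` picks left. The last one to pick wins iff the
list of all picks satisfies `Ψ`. -/
def MoverWins (Ψ : List ℕ → Prop) : ℕ → List ℕ → Prop
  | 0, xs => ¬ Ψ xs
  | k + 1, xs => ∃ x, (xs.length = 1 → x ≤ 1) ∧ ¬ MoverWins Ψ k (x :: xs)

open Classical in
/-- Complete the current pick iff this is good for the agent to move. -/
noncomputable def pickStrategy (Ψ : List ℕ → Prop) (n : ℕ) (v : List Bool) : Bool :=
  decide (¬ MoverWins Ψ (n + 2 - (picks v).1.length)
    ((if (picks v).1.length = 1 then 1 else (picks v).2) :: (picks v).1))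

theorem pickStrategy_eq_true_iff {Ψ : List ℕ → Prop} {n : ℕ} {v : List Bool} {xs : List ℕ}
    {c : ℕ} (h : picks v = (xs, c)) : pickStrategy Ψ n v = true ↔
      ¬ MoverWins Ψ (n + 2 - xs.length) ((if xs.length = 1 then 1 else c) :: xs) := by
  classical
  rw [pickStrategy, decide_eq_true_iff, h]

theorem pickTurn_eq_iff {v : List Bool} {a : Player} :
    pickTurn v = a ↔ (picks v).1.length % 2 = (a : ℕ) := by
  unfold pickTurn
  have h2 := Nat.mod_lt (picks v).1.length (show 2 > 0 by norm_num)
  generalize (picks v).1.length % 2 = l at *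
  interval_cases l <;> revert a <;> decide

theorem picks_concat (v : List Bool) (b : Bool) : picks (v ++ [b]) = pickStep (picks v) b := by
  simp [picks]

theorem picks_pre_succ (x : Cantor) (k : ℕ) :
    picks (pre x (k + 1)) = pickStep (picks (pre x k)) (x k) := by
  rw [pre_succ, picks_concat]

theorem pickStep_cases (q : List ℕ × ℕ) (b : Bool) :
    (pickStep q b).1 = q.1 ∨ ∃ y, (pickStep q b).1 = y :: q.1 := by
  unfold pickStep
  split_ifs <;> simp

theorem length_picks_mono (x : Cantor) :
    Monotone fun k => (picks (pre x k)).1.length := by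
  refine monotone_nat_of_le_succ fun k => ?_
  simp only [picks_pre_succ]
  rcases pickStep_cases (picks (pre x k)) (x k) with h | ⟨y, h⟩ <;> simp [h]

theorem exists_length_picks (x : Cantor) {j l : ℕ} (hl : l ≤ (picks (pre x j)).1.length) :
    ∃ k ≤ j, (picks (pre x k)).1.length = l := by
  induction j with
  | zero => exact ⟨0, le_rfl, (Nat.le_zero.1 hl).symm⟩
  | succ j IH =>
    by_cases h : l ≤ (picks (pre x j)).1.length
    · obtain ⟨k, hk, h⟩ := IH h
      exact ⟨k, by omega, h⟩
    · refine ⟨j + 1, le_rfl, le_antisymm ?_ hl⟩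
      rw [picks_pre_succ]
      rcases pickStep_cases (picks (pre x j)) (x j) with h' | ⟨y, h'⟩ <;> simp [h'] <;> omega

theorem picks_eq_of_length_eq (x : Cantor) {j k : ℕ} (hjk : j ≤ k)
    (h : (picks (pre x k)).1.length = (picks (pre x j)).1.length) :
    (picks (pre x k)).1 = (picks (pre x j)).1 := by
  induction k, hjk using Nat.le_induction with
  | base => rfl
  | succ k hk IH =>
    have h₁ := length_picks_mono x hk
    rw [picks_pre_succ] at h ⊢
    dsimp only at h₁
    rcases pickStep_cases (picks (pre x k)) (x k) with h' | ⟨y, h'⟩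
    · rw [h'] at h ⊢
      exact IH h
    · rw [h', List.length_cons] at h
      omega

theorem picks_of_forall_false {x : Cantor} {j : ℕ} {xs : List ℕ} (hx : picks (pre x j) = (xs, 0))
    (hl : xs.length ≠ 1) {t : ℕ} (ht : ∀ i < t, x (j + i) = false) :
    picks (pre x (j + t)) = (xs, t) := by
  induction t with
  | zero => exact hx
  | succ t IH =>
    rw [← add_assoc, picks_pre_succ, IH fun i hi => ht i (by omega), ht t (by omega)]
    simp [pickStep, hl]

section PickGame

variable {Ψ : List ℕ → Prop} {n : ℕ} {x : Cantor}

/-- The parity makes the agent who owes the next pick lose. For `β > n` at most two picks are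
complete and no open set is entered, so agent 0 loses. This is right because agent 1 cannot stall at
the second pick, which is a single bit; hence `n + 1` open sets suffice. -/
theorem mem_pickSet_iff {j β : ℕ} (hj : (picks (pre x j)).1.length + β = n + 3) (hβ : 0 < β)
    (hmin : ∀ i < β, x ∉ pickOpen Ψ n i) :
    x ∈ pickSet Ψ n ↔ β < n + 1 ∧ β % 2 ≠ (n + 1) % 2 := by
  by_cases h : β < n + 1
  · have hmem : x ∈ pickOpen Ψ n β := ⟨j, hj, fun h => by omega⟩
    rw [pickSet, mem_diffSet_of_mem h hmem hmin]
    simp [h]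
  · simp only [h, false_and, iff_false]
    exact notMem_diffSet fun k hk => hmin k (by omega)

/-- The strategy `pickStrategy` wins from every position that is won in the sense of `MoverWins`. -/
theorem mem_pickSet_of_pickStrategy {a : Player} {j₀ : ℕ}
    (hx : ∀ k ≥ j₀, pickTurn (pre x k) = a → x k = pickStrategy Ψ n (pre x k)) (k : ℕ) :
    ∀ j ≥ j₀, ∀ xs, picks (pre x j) = (xs, 0) → xs.length + k = n + 3 →
      (xs.length % 2 = (a : ℕ) ↔ MoverWins Ψ k xs) → (x ∈ pickSet Ψ n ↔ (a : ℕ) = 0) := by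
  have ha := a.2
  induction k with
  | zero =>
    intro j _ xs hj hlen hwin
    have h0 : x ∈ pickOpen Ψ n 0 ↔ Ψ xs := by
      constructor
      · rintro ⟨k, hk, h⟩
        have hk' : (picks (pre x k)).1.length = (picks (pre x j)).1.length := by
          rw [hj]
          dsimp only
          omega
        rcases le_total j k with hjk | hjk
        · have h' := picks_eq_of_length_eq x hjk hk'
          rw [hj] at h'
          rw [← show (picks (pre x k)).1 = xs from h']
          exact h rfl
        · have h' := picks_eq_of_length_eq x hjk hk'.symm
          rw [hj] at h'
          rw [show xs = (picks (pre x k)).1 from h']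
          exact h rfl
      · exact fun h => ⟨j, by rw [hj]; exact hlen, fun _ => by rw [hj]; exact h⟩
    by_cases hΨ : Ψ xs
    · rw [pickSet, mem_diffSet_of_mem (Nat.succ_pos n) (h0.2 hΨ) (by simp)]
      simp only [MoverWins, hΨ, not_true, iff_false] at hwin
      omega
    · obtain ⟨i, -, hi⟩ := exists_length_picks x (j := j) (l := n + 2) (by rw [hj]; dsimp; omega)
      rw [mem_pickSet_iff (j := i) (β := 1) (by omega) one_pos]
      · simp only [MoverWins, hΨ, not_false_iff, iff_true] at hwin
        omega
      · intro i hi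
        obtain rfl : i = 0 := by omega
        exact fun h => hΨ (h0.1 h)
  | succ k IH =>
    intro j hj₀ xs hj hlen hwin
    have hrem : n + 2 - xs.length = k := by omega
    by_cases hl : xs.length = 1
    · have hnext : picks (pre x (j + 1)) = ((x j).toNat :: xs, 0) := by
        rw [picks_pre_succ, hj]
        simp [pickStep, hl]
      refine IH (j + 1) (by omega) _ hnext (by simp; omega) ?_
      rw [List.length_cons]
      by_cases hm : xs.length % 2 = (a : ℕ)
      · obtain ⟨y, hy, hyw⟩ := hwin.1 hm
        have hy := hy hl
        have hmove := hx j hj₀ (pickTurn_eq_iff.2 (by rw [hj]; exact hm))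
        have hmove : x j = true ↔ ¬ MoverWins Ψ k (1 :: xs) := by
          rw [hmove, pickStrategy_eq_true_iff hj, hrem, if_pos hl]
        have : ¬ MoverWins Ψ k ((x j).toNat :: xs) := by
          by_cases h1 : MoverWins Ψ k (1 :: xs)
          · have hxj : x j = false := by simpa [h1] using hmove
            have hy0 : y = 0 := by
              rcases Nat.le_one_iff_eq_zero_or_eq_one.1 hy with h | h
              · exact h
              · exact absurd (h ▸ h1) hyw
            subst hy0
            simpa [hxj] using hyw
          · have hxj : x j = true := by simpa [h1] using hmove
            simpa [hxj] using h1
        simp only [this, iff_false]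
        omega
      · have : MoverWins Ψ k ((x j).toNat :: xs) := by
          by_contra hcon
          exact hm (hwin.2 ⟨_, fun _ => Bool.toNat_le _, hcon⟩)
        simp only [this, iff_true]
        omega
    · by_cases hex : ∃ t, x (j + t) = true
      · classical
        have hmin : ∀ i < Nat.find hex, x (j + i) = false := fun i hi => by
          simpa using Nat.find_min hex hi
        have ht := Nat.find_spec hex
        generalize Nat.find hex = t at hmin ht
        have hcount := picks_of_forall_false hj hl hmin
        have hnext : picks (pre x (j + t + 1)) = (t :: xs, 0) := by
          rw [picks_pre_succ, hcount, ht]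
          simp [pickStep, hl]
        refine IH _ (by omega) _ hnext (by simp; omega) ?_
        rw [List.length_cons]
        by_cases hm : xs.length % 2 = (a : ℕ)
        · have hmove := hx (j + t) (by omega) (pickTurn_eq_iff.2 (by rw [hcount]; exact hm))
          rw [ht, eq_comm, pickStrategy_eq_true_iff hcount, hrem, if_neg hl] at hmove
          simp only [hmove, iff_false]
          omega
        · have : MoverWins Ψ k (t :: xs) := by
            by_contra hcon
            exact hm (hwin.2 ⟨_, fun h => absurd h hl, hcon⟩)
          simp only [this, iff_true]
          omega
      · push Not at hex
        have hcount : ∀ t, picks (pre x (j + t)) = (xs, t) := fun t =>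
          picks_of_forall_false hj hl fun i _ => by simpa using hex i
        have hm : xs.length % 2 ≠ (a : ℕ) := by
          intro hm
          obtain ⟨y, -, hy⟩ := hwin.1 hm
          have hmove := hx (j + y) (by omega) (pickTurn_eq_iff.2 (by rw [hcount]; exact hm))
          refine hex y ?_
          rw [hmove, pickStrategy_eq_true_iff (hcount y), hrem, if_neg hl]
          exact hy
        rw [mem_pickSet_iff (j := j) (β := k + 1) (by rw [hj]; exact hlen) (by omega)]
        · omega
        · rintro i hi ⟨m, hm, -⟩
          have := length_picks_mono x (show m ≤ j + m by omega)
          simp only [hcount] at this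
          omega

theorem val_eq_of_mem_iff {turn : List Bool → Player} {W : Set Cantor} {a : Player}
    (h : x ∈ W ↔ (a : ℕ) = 0) : (winLose turn W).val x = a := by
  unfold winLose
  by_cases ha : a = 0
  · subst ha
    simp [h]
  · obtain rfl := Fin.eq_one_of_ne_zero a ha
    simp [h]

theorem isWinningFor_pickStrategy {a : Player} (h : (0 = (a : ℕ) ↔ MoverWins Ψ (n + 3) [])) :
    IsWinningFor (winLose pickTurn (pickSet Ψ n)) (pickStrategy Ψ n) a := by
  intro τ hτ
  refine val_eq_of_mem_iff (mem_pickSet_of_pickStrategy (j₀ := 0) (fun k _ hk => ?_) (n + 3) 0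
    le_rfl [] rfl (by simp) (by simpa using h))
  rw [play_apply, hτ _ hk]

end PickGame

/-- The history after agent `0` has picked `i`. -/
def firstPick (i : ℕ) : List Bool := (List.range i).map (fun _ => false) ++ [true]

/-- Agent 1 must win in equilibrium, as otherwise `pickStrategy` is a profitable deviation. If some
answer to a first pick `i` were bad, agent 0 would deviate by picking `i` and playing `pickStrategy`
afterwards. So answers off the equilibrium play are correct too. -/
theorem not_moverWins_of_isNash {Ψ : List ℕ → Prop} {n : ℕ} {σ : List Bool → Bool}
    (hσ : (winLose pickTurn (pickSet Ψ n)).IsNash σ) (hwin : ¬ MoverWins Ψ (n + 3) []) (i : ℕ) :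
    ¬ MoverWins Ψ (n + 1) [(σ (firstPick i)).toNat, i] := by
  intro hS
  set G := winLose pickTurn (pickSet Ψ n) with hG
  have hval : G.val (play σ) = 1 := by
    by_contra hne
    classical
    refine hσ 1 (fun h => if pickTurn h = 1 then pickStrategy Ψ n h else σ h)
      (fun h hh => if_neg hh) ⟨hne, ?_⟩
    exact isWinningFor_pickStrategy (a := 1) (by simpa using hwin) _ fun h hh => if_pos hh
  classical
  -- At length at most `i` this plays `i` times `false` and then `true`, which is the pick `i` in
  -- unary.
  let τ : List Bool → Bool := fun h => if pickTurn h = 0 then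
    (if h.length ≤ i then decide (h.length = i) else pickStrategy Ψ n h) else σ h
  refine hσ 0 τ (fun h hh => if_neg hh) ⟨by rw [hval]; decide, ?_⟩
  have hτ : ∀ k, pickTurn (pre (play τ) k) = 0 → play τ k =
      if k ≤ i then decide (k = i) else pickStrategy Ψ n (pre (play τ) k) := fun k hk => by
    rw [play_apply]
    simp only [τ, hk, if_true, length_pre]
  have hcount : ∀ t ≤ i, picks (pre (play τ) t) = ([], t) := by
    intro t ht
    induction t with
    | zero => rfl
    | succ t IH =>
      have IH := IH (by omega)
      rw [picks_pre_succ, hτ t (pickTurn_eq_iff.2 (by rw [IH]; rfl)), IH, if_pos (by omega)]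
      have : t ≠ i := by omega
      simp [pickStep, this]
  have hmove : play τ i = true := by
    rw [hτ i (pickTurn_eq_iff.2 (by rw [hcount i le_rfl]; rfl))]
    simp
  have hpre : pre (play τ) (i + 1) = firstPick i := by
    rw [pre_succ, hmove, firstPick, pre]
    congr 1
    refine List.map_congr_left fun t ht => ?_
    have ht := List.mem_range.1 ht
    rw [hτ t (pickTurn_eq_iff.2 (by rw [hcount t ht.le]; rfl)), if_pos ht.le]
    simp [ht.ne]
  have h₁ : picks (pre (play τ) (i + 1)) = ([i], 0) := by
    rw [picks_pre_succ, hcount i le_rfl, hmove]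
    simp [pickStep]
  have h₂ : picks (pre (play τ) (i + 2)) = ([(σ (firstPick i)).toNat, i], 0) := by
    have hmv : play τ (i + 1) = σ (firstPick i) := by
      have : pickTurn (firstPick i) ≠ 0 := by
        rw [← hpre, ne_eq, pickTurn_eq_iff, h₁]
        simp
      rw [play_apply, hpre]
      simp only [τ, this, if_false]
    rw [picks_pre_succ, h₁, hmv]
    simp [pickStep]
  refine val_eq_of_mem_iff (mem_pickSet_of_pickStrategy (j₀ := i + 2) (fun k hk hk' => ?_) (n + 1)
    (i + 2) le_rfl _ h₂ (by simp; omega) (by simpa using hS))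
  rw [hτ k hk', if_neg (by omega)]

/-! ## Quantifying over limits -/

/-- `jumpPred ψ p` expresses the truth of `ψ` at the limit of `p` with two more quantifiers. -/
def jumpPred (ψ : Baire → List ℕ → Prop) (p : Baire) (zs : List ℕ) : Prop :=
  (zs.getD 1 0).unpair.2 ≤ zs.getD 0 0 ∧
    ¬ ψ (fun k => p (Nat.pair k (zs.getD 0 0))) ((zs.getD 1 0).unpair.1 :: zs.drop 2)

theorem LimDec.jumpPred {ψ : Baire → List ℕ → Prop} (hψ : LimDec 0 ψ) :
    LimDec 0 (jumpPred ψ) := by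
  have h0 : Primrec fun zs : List ℕ => zs.getD 0 0 :=
    (Primrec.list_getD 0).comp Primrec.id (Primrec.const 0)
  have h1 : Primrec fun zs : List ℕ => (zs.getD 1 0).unpair :=
    Primrec.unpair.comp ((Primrec.list_getD 0).comp Primrec.id (Primrec.const 1))
  have hle : LimDec 0 fun (_ : Baire) (zs : List ℕ) => (zs.getD 1 0).unpair.2 ≤ zs.getD 0 0 :=
    LimDec.of_primrecPred (Primrec.nat_le.comp (Primrec.snd.comp h1) h0)
  obtain ⟨F, hF, h⟩ := hψ
  have hcol : BoundedUse fun p (z : List ℕ × ℕ) => p (Nat.pair z.2 (z.1.getD 0 0)) :=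
    BoundedUse.oracle.comp (Primrec₂.natPair.comp Primrec.snd (h0.comp Primrec.fst))
  have hsub : LimDec 0 fun p (zs : List ℕ) =>
      ψ (fun k => p (Nat.pair k (zs.getD 0 0))) ((zs.getD 1 0).unpair.1 :: zs.drop 2) :=
    ⟨_, BoundedUse.subst hF hcol (f := fun zs => (zs.getD 1 0).unpair.1 :: zs.drop 2)
      (Primrec.list_cons.comp (Primrec.fst.comp h1)
        (Primrec.list_drop.comp (Primrec.const 2) Primrec.id)), fun p zs => h _ _⟩
  exact hle.and hsub.not

/-- The truth value depends on a prefix of fixed length, and the columns eventually agree with the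
limit on it. -/
theorem eventually_iff_of_isLim {ψ : Baire → List ℕ → Prop} (hψ : LimDec 0 ψ) {p q : Baire}
    (hpq : IsLim p q) (zs : List ℕ) :
    ∀ᶠ t in atTop, (ψ (fun k => p (Nat.pair k t)) zs ↔ ψ q zs) := by
  obtain ⟨F, ⟨u, g, -, -, hFg⟩, h⟩ := hψ
  have hall : ∀ U, ∀ᶠ t in atTop, pre (fun k => p (Nat.pair k t)) U = pre q U := by
    intro U
    induction U with
    | zero => simp [pre]
    | succ U IH =>
      filter_upwards [IH, hpq U] with t h₁ h₂
      rw [pre_succ, pre_succ, h₁, h₂]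
  filter_upwards [hall (u zs)] with t ht
  rw [← h, ← h, hFg, hFg, ht]

/-- The last mover's witness `y` becomes a pair `⟨y, N⟩`, where `N` bounds the stage of convergence,
and the opponent may challenge it with any `t ≥ N`. The negation in `jumpPred` reflects that the
challenger now picks last. With two picks made, the restriction to a bit no longer applies. -/
theorem moverWins_jumpPred {ψ : Baire → List ℕ → Prop} (hψ : LimDec 0 ψ) {p q : Baire}
    (hpq : IsLim p q) (k : ℕ) {xs : List ℕ} (hxs : 2 ≤ xs.length) :
    MoverWins (ψ q) (k + 1) xs ↔ MoverWins (jumpPred ψ p) (k + 2) xs := by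
  induction k generalizing xs with
  | zero =>
    have hl : xs.length ≠ 1 := by omega
    have hl' : xs ≠ [] := by rintro rfl; simp at hxs
    simp only [MoverWins, hl, hl', false_imp_iff, true_and, not_not, List.length_cons,
      Nat.add_eq_right, List.length_eq_zero_iff, not_exists, jumpPred, List.getD_cons_zero,
      List.getD_cons_succ, List.drop_succ_cons, List.drop_zero, not_and]
    constructor
    · rintro ⟨y, hy⟩
      obtain ⟨N, hN⟩ := eventually_atTop.1 (eventually_iff_of_isLim hψ hpq (y :: xs))
      refine ⟨Nat.pair y N, fun t ht => ?_⟩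
      rw [Nat.unpair_pair] at ht ⊢
      exact (hN t ht).2 hy
    · rintro ⟨y, hy⟩
      refine ⟨y.unpair.1, ?_⟩
      obtain ⟨t, ht, ht'⟩ := ((eventually_iff_of_isLim hψ hpq (y.unpair.1 :: xs)).and
        (eventually_ge_atTop y.unpair.2)).exists
      exact ht.1 (hy t ht')
  | succ k IH =>
    rw [MoverWins, MoverWins]
    exact exists_congr fun y => and_congr_right fun _ => not_congr (IH (by simp; omega))

theorem exists_moverWins_iff_of_isIterLim {ψ : Baire → List ℕ → Prop} (hψ : LimDec 0 ψ) (n : ℕ) :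
    ∃ ψ' : Baire → List ℕ → Prop, LimDec 0 ψ' ∧ ∀ p q, IsIterLim n p q → ∀ xs : List ℕ,
      2 ≤ xs.length → (MoverWins (ψ' p) (n + 1) xs ↔ MoverWins (ψ q) 1 xs) := by
  induction n with
  | zero => exact ⟨ψ, hψ, by rintro p _ rfl xs _; rfl⟩
  | succ n IH =>
    obtain ⟨ψ', hψ', h⟩ := IH
    refine ⟨_, hψ'.jumpPred, ?_⟩
    rintro p q ⟨r, hr, hq⟩ xs hxs
    rw [← h r q hq xs hxs, moverWins_jumpPred hψ' hr n hxs]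

/-! ## Names of picking games -/

theorem primrec_picks : Primrec picks := by
  have hq : Primrec fun z : List Bool × (List ℕ × ℕ) × Bool => z.2.1 :=
    Primrec.fst.comp Primrec.snd
  have hb : Primrec fun z : List Bool × (List ℕ × ℕ) × Bool => z.2.2 :=
    Primrec.snd.comp Primrec.snd
  have hxs := Primrec.fst.comp hq
  have hc := Primrec.snd.comp hq
  have hstep : Primrec₂ fun (_ : List Bool) (z : (List ℕ × ℕ) × Bool) => pickStep z.1 z.2 := by
    refine Primrec.ite (Primrec.eq.comp (Primrec.list_length.comp hxs) (Primrec.const 1))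
      (Primrec.pair (Primrec.list_cons.comp ((Primrec.dom_bool Bool.toNat).comp hb) hxs)
        (Primrec.const 0))
      (Primrec.ite (Primrec.eq.comp hb (Primrec.const true))
        (Primrec.pair (Primrec.list_cons.comp hc hxs) (Primrec.const 0))
        (Primrec.pair hxs (Primrec.succ.comp hc)))
  exact Primrec.list_foldl Primrec.id (Primrec.const ([], 0)) hstep

/-- The picking game for `Ψ` as an input of `Det` and `Win`. -/
def pickGame {Ψ : List ℕ → Prop} {n : ℕ} (h : ∀ β, IsOpen (pickOpen Ψ n β)) :
    (List Bool → Player) × (diffClass (n + 1)).sets :=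
  (pickTurn, ⟨pickSet Ψ n, fun β => pickOpen Ψ n β, fun β => h β, rfl⟩)

theorem exists_pickGame_name {ψ : Baire → List ℕ → Prop} (hψ : LimDec 0 ψ) (n : ℕ) :
    ∃ H : Baire → ℕ → ℕ, TotalFunctional H ∧ ∀ p, ∃ h : ∀ β, IsOpen (pickOpen (ψ p) n β),
      (Det (diffClass (n + 1))).δX.names (H p) (pickGame h) := by
  have hlen : Primrec fun z : ℕ × List Bool => (picks z.2).1.length :=
    Primrec.list_length.comp (Primrec.fst.comp (primrec_picks.comp Primrec.snd))
  have hβ : Primrec fun z : ℕ × List Bool => z.1.unpair.1 :=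
    Primrec.fst.comp (Primrec.unpair.comp Primrec.fst)
  have h₁ : LimDec 0 fun (_ : Baire) (z : ℕ × List Bool) =>
      (picks z.2).1.length + z.1.unpair.1 = n + 3 :=
    LimDec.eq (LimUse.of_primrec (Primrec.nat_add.comp hlen hβ))
      (LimUse.of_primrec (Primrec.const _))
  have h₂ : LimDec 0 fun (_ : Baire) (z : ℕ × List Bool) => z.1.unpair.1 = 0 :=
    LimDec.eq (LimUse.of_primrec hβ) (LimUse.of_primrec (Primrec.const _))
  have h₃ : LimDec 0 fun p (z : ℕ × List Bool) => ψ p (picks z.2).1 :=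
    hψ.comp (Primrec.fst.comp (primrec_picks.comp Primrec.snd))
  obtain ⟨F, hF, hFψ⟩ := (h₁.and (h₂.imp h₃)).exists_mem
    (l := fun k : ℕ => (decode (α := List Bool) k.unpair.2).toList)
    (Primrec.optionToList.comp (Primrec.decode.comp (Primrec.snd.comp Primrec.unpair)))
  have hhalf : Primrec fun N : ℕ => N / 2 := Primrec.nat_div.comp Primrec.id (Primrec.const 2)
  have hturn : Primrec fun N : ℕ =>
      (picks ((decode (α := List Bool) (N / 2)).getD [])).1.length % 2 :=
    Primrec.nat_mod.comp (Primrec.list_length.comp (Primrec.fst.comp (primrec_picks.comp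
      (Primrec.option_getD.comp (Primrec.decode.comp hhalf) (Primrec.const []))))) (Primrec.const 2)
  have hpar : Primrec fun N : ℕ => decide (N % 2 = 0) :=
    (Primrec.eq.comp (Primrec.nat_mod.comp Primrec.id (Primrec.const 2)) (Primrec.const 0)).decide
  -- Even entries tabulate the turns. Entry `2 * ⟨β, j⟩ + 1` lists the word with code `j` in the
  -- open set of index `β` when its picks qualify; the `+ 1` keeps 0 for no information.
  have hH : LimUse 0 fun p N => bif decide (N % 2 = 0) then
      (picks ((decode (α := List Bool) (N / 2)).getD [])).1.length % 2
      else bif F p (N / 2) then (N / 2).unpair.2 + 1 else 0 :=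
    (LimUse.of_primrec hpar).ite_bool (LimUse.of_primrec hturn) ((hF.comp hhalf).ite_bool
      (LimUse.of_primrec (Primrec.succ.comp (Primrec.snd.comp (Primrec.unpair.comp hhalf))))
      (LimUse.of_primrec (Primrec.const 0)))
  refine ⟨_, BoundedUse.totalFunctional hH, fun p => ?_⟩
  have hopen : ∀ β, pickOpen (ψ p) n β =
      openOf fun j => bif F p (Nat.pair β j) then j + 1 else 0 := by
    intro β
    ext x
    constructor
    · rintro ⟨k, hk⟩
      refine ⟨encode (pre x k), k, ?_⟩
      have : F p (Nat.pair β (encode (pre x k))) = true := by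
        rw [hFψ]
        exact ⟨pre x k, by simp, by simpa using hk⟩
      simp [this]
    · rintro ⟨j, k, hj⟩
      cases hFj : F p (Nat.pair β j) with
      | false => simp [hFj] at hj
      | true =>
        simp only [hFj, cond_true, Nat.add_right_cancel_iff] at hj
        obtain ⟨v, hv, hv'⟩ := (hFψ p _).1 hFj
        simp only [Nat.unpair_pair, hj, encodek, Option.toList_some, List.mem_singleton] at hv hv'
        subst hv
        exact ⟨k, hv'⟩
  refine ⟨fun β => by rw [hopen]; exact isOpen_openOf _, fun v => ?_, ?_⟩
  · have h2 : 2 * encode v / 2 = encode v := by omega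
    simp only [Nat.mul_mod_right, decide_true, cond_true, h2, encodek, Option.getD_some]
    have h3 := pickTurn_eq_iff.1 (rfl : pickTurn v = _)
    rw [h3]
    rfl
  · show pickSet (ψ p) n = _
    unfold pickSet
    congr 1
    funext β
    rw [hopen]
    congr 1
    funext j
    have h2 : (2 * Nat.pair β j + 1) / 2 = Nat.pair β j := by omega
    simp [h2]

/-! ## The lower bounds -/

theorem moverWins_all_iff {Ψ : List ℕ → Prop} {k : ℕ} :
    MoverWins Ψ (k + 2) [] ↔ ∃ i, ∀ b ≤ 1, MoverWins Ψ k [b, i] := by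
  simp [MoverWins]

theorem HasWinningStrategy.eq {G : SeqGame Player Bool Player} {a c : Player}
    (ha : HasWinningStrategy G a) (hc : HasWinningStrategy G c) : a = c := by
  by_contra hne
  obtain ⟨σ, hσ⟩ := ha
  obtain ⟨ρ, hρ⟩ := hc
  classical
  -- The two winning strategies are played against each other.
  let τ : List Bool → Bool := fun h => if G.turn h = a then σ h else ρ h
  have h₁ := hσ τ fun h hh => if_pos hh
  have h₂ := hρ τ fun h hh => if_neg (by rw [hh]; exact Ne.symm hne)
  exact hne (h₁.symm.trans h₂)

theorem lpo_le_win (n : ℕ) : WeihrauchLE (LPO.jump n) (Win (diffClass (n + 1))) := by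
  classical
  have hψ : LimDec 0 fun p (zs : List ℕ) => ¬ p (zs.getD 0 0) = 0 :=
    (LimDec.eq (LimUse.of_boundedUse (BoundedUse.oracle.comp
      ((Primrec.list_getD 0).comp Primrec.id (Primrec.const 0))))
      (LimUse.of_primrec (Primrec.const 0))).not
  obtain ⟨ψ, hψ, hlim⟩ := exists_moverWins_iff_of_isIterLim hψ n
  obtain ⟨H, hH, hname⟩ := exists_pickGame_name hψ n
  refine WeihrauchLE.of_totalFunctional .second hH fun p x hp _ => ?_
  obtain ⟨q, hq, rfl⟩ := (Representation.iterJump_names baireRep).1 hp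
  obtain ⟨hopen, hg⟩ := hname p
  have hiff : MoverWins (ψ p) (n + 3) [] ↔ ¬ q = fun _ => 0 := by
    have h : ∀ i b, MoverWins (ψ p) (n + 1) [b, i] ↔ ¬ q = fun _ => 0 := by
      intro i b
      rw [hlim p q hq _ (by simp), funext_iff]
      simp [MoverWins]
    simp only [moverWins_all_iff (k := n + 1), h]
    exact ⟨fun ⟨_, h⟩ => h 0 (by simp), fun h => ⟨0, fun _ _ => h⟩⟩
  let w : Player := if q = fun _ => 0 then 1 else 0
  have hw : HasWinningStrategy (winLose pickTurn (pickSet (ψ p) n)) w := by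
    refine ⟨_, isWinningFor_pickStrategy ?_⟩
    rw [hiff]
    by_cases h0 : q = fun _ => 0 <;> simp [w, h0]
  refine ⟨_, hg, ⟨w, hw⟩, ?_⟩
  intro r (a : Player) ha (hr : r 0 = encode a)
  obtain rfl : a = w := HasWinningStrategy.eq ha hw
  refine ⟨_, rfl, ?_⟩
  show pairB p r (2 * 0 + 1) = _
  rw [pairB_odd, hr]
  by_cases h0 : q = fun _ => 0
  · rw [decide_eq_true h0]
    simp only [w, h0, if_true]
    rfl
  · rw [decide_eq_false h0]
    simp only [w, h0, if_false]
    rfl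

/-- A cylinder around `v` is listed in `q` before entry `s`. -/
def Listed (q : Baire) (_m s : ℕ) (v : List Bool) : Prop :=
  ∃ j < s, ∃ k < v.length + 1, q j = encode (v.take k) + 1

theorem isRecognition_listed (q : Baire) : IsRecognition (Listed q) where
  mono m s t w hst := by
    rintro ⟨j, hj, h⟩
    exact ⟨j, hj.trans_le hst, h⟩
  concat := by
    rintro m s w b ⟨j, hj, k, hk, h⟩
    refine ⟨j, hj, k, by simp; omega, ?_⟩
    rw [h, List.take_append_of_le_length (by omega)]

/-- At stage `s` it is known that the cylinder of `w` is covered by the open set named by `q`. -/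
def Covered (q : Baire) (s : ℕ) (w : List Bool) : Prop :=
  Reach (fun _ => 1) (Target (Listed q) 0 (Att (fun _ => 1) (Listed q) 0 (1 - 0))) 0 s w

theorem limDec_covered : LimDec 0 fun q (z : ℕ × List Bool) => Covered q z.1 z.2 := by
  have hv : Primrec fun z : ((ℕ × List Bool) × ℕ) × ℕ => z.1.1.2 :=
    Primrec.snd.comp (Primrec.fst.comp Primrec.fst)
  have ho : LimUse 0 fun p (z : ((ℕ × List Bool) × ℕ) × ℕ) => p z.1.2 :=
    LimUse.of_boundedUse (BoundedUse.oracle.comp (Primrec.snd.comp Primrec.fst))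
  have he := LimDec.eq ho (LimUse.of_primrec (n := 0) (Primrec.succ.comp
    (Primrec.encode.comp (Primrec.list_take.comp Primrec.snd hv))))
  have h := (he.exists_lt (u := fun z => z.1.2.length + 1)
    (Primrec.succ.comp (Primrec.list_length.comp (Primrec.snd.comp Primrec.fst)))).exists_lt
      (u := fun z => z.1) Primrec.fst
  have hL : LimDec 0 fun p (z : ℕ × List Bool) => Listed p 0 z.1 z.2 :=
    h.of_iff fun p z => Iff.rfl
  exact limDec_reach (turn := fun _ _ => 1) (LimDec.const _)
    (limDec_target 0 hL (W := fun q => Att (fun _ => 1) (Listed q) 0 (1 - 0)) (LimDec.const False))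

section Covered

variable {q : Baire}

theorem Covered.mono {s t : ℕ} (hst : s ≤ t) {w : List Bool} (h : Covered q s w) :
    Covered q t w :=
  Reach.mono (Target.mono (isRecognition_listed q) _ _) hst h

/-- All turns belong to agent 1, so agent 0 forces a target only if every continuation meets one;
this is the step equivalence at level 1. -/
theorem exists_covered_iff {w : List Bool} :
    (∃ s, Covered q s w) ↔ ∀ b, ∃ s, Covered q s (w ++ [b]) := by
  have h := Att.iff_step (turn := fun _ => 1) (isRecognition_listed q) 1 0 w
  exact h.trans ⟨fun h => h.2 (by decide), fun h => ⟨fun h' => absurd h' (by decide), fun _ => h⟩⟩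

theorem mem_openOf_of_covered {s : ℕ} (h : Covered q s []) (x : Cantor) : x ∈ openOf q := by
  have hopt := (Allowed.optimal (turn := fun _ => 1) (isRecognition_listed q) 1 0 x 0).1 ⟨s, h⟩
    fun _ _ h' => absurd h' (by decide)
  obtain ⟨⟨k, t, j, -, l, hl, hj⟩, -⟩ := hopt
  rw [pre_take _ (by simpa using Nat.lt_succ_iff.1 hl)] at hj
  exact ⟨j, l, hj⟩

theorem notMem_openOf {x : Cantor} (h : ∀ k s, ¬ Covered q s (pre x k)) : x ∉ openOf q := by
  rintro ⟨j, k, hj⟩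
  have hL : Listed q 0 (j + 1) (pre x k) :=
    ⟨j, by omega, k, by simp, by rw [pre_take _ le_rfl]; exact hj⟩
  -- `Att` at level 0 is `False`, so its negation is `id`: a listed cylinder is covered.
  obtain ⟨s, hs⟩ := (Att.succ_iff (turn := fun _ => 1) (a := 0) (isRecognition_listed q) hL).2 id
  exact h k s hs

end Covered

/-- The move `b` at `w` is refuted at a stage when the other one is not. -/
def Refuted (q : Baire) (zs : List ℕ) : Prop :=
  Covered q (zs.getD 0 0) ((decode (α := List Bool) (zs.getD 2 0)).getD [] ++
      [decide (zs.getD 1 0 = 1)]) ∧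
    ¬ Covered q (zs.getD 0 0) ((decode (α := List Bool) (zs.getD 2 0)).getD [] ++
      [!decide (zs.getD 1 0 = 1)])

theorem limDec_refuted : LimDec 0 Refuted := by
  have hget : ∀ i, Primrec fun zs : List ℕ => zs.getD i 0 := fun i =>
    (Primrec.list_getD 0).comp Primrec.id (Primrec.const i)
  have hw : Primrec fun zs : List ℕ => (decode (α := List Bool) (zs.getD 2 0)).getD [] :=
    Primrec.option_getD.comp (Primrec.decode.comp (hget 2)) (Primrec.const [])
  have hb : Primrec fun zs : List ℕ => decide (zs.getD 1 0 = 1) :=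
    (Primrec.eq.comp (hget 1) (Primrec.const 1)).decide
  exact (limDec_covered.comp (Primrec.pair (hget 0) (Primrec.list_concat.comp hw hb))).and
    (limDec_covered.comp (Primrec.pair (hget 0)
      (Primrec.list_concat.comp hw (Primrec.not.comp hb)))).not

theorem moverWins_refuted_iff {q : Baire} {w : List Bool} {b : Bool} :
    MoverWins (Refuted q) 1 [b.toNat, encode w] ↔
      ∃ s, Covered q s (w ++ [b]) ∧ ¬ Covered q s (w ++ [!b]) := by
  cases b <;> simp [MoverWins, Refuted]

/-- If both bits were refuted, each at a stage when the other is not yet covered, monotonicity would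
fail at the later stage. Numbers that code no word are read as the empty word, so this holds for
every first pick. -/
theorem exists_not_moverWins_refuted (q : Baire) (i : ℕ) :
    ∃ b ≤ 1, ¬ MoverWins (Refuted q) 1 [b, i] := by
  by_contra hcon
  push Not at hcon
  have h0 := hcon 0 (by simp)
  have h1 := hcon 1 le_rfl
  simp only [MoverWins, Refuted, List.length_cons, List.length_nil, not_not, List.getD_cons_zero,
    List.getD_cons_succ] at h0 h1
  obtain ⟨s, -, hs, hs'⟩ := h0
  obtain ⟨t, -, ht, ht'⟩ := h1
  simp only [Nat.zero_ne_one, decide_false, decide_true, Bool.not_false, Bool.not_true]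
    at hs hs' ht ht'
  rcases le_total s t with h | h
  · exact ht' (hs.mono h)
  · exact hs' (ht.mono h)

/-- The code of the history after the first agent has picked `c`. -/
theorem primrec_encode_firstPick : Primrec fun c => encode (firstPick c) := by
  have h : Primrec fun c : ℕ => (List.range c).map fun _ => false :=
    Primrec.list_map Primrec.list_range (Primrec₂.const false)
  exact Primrec.encode.comp (Primrec.list_concat.comp h (Primrec.const true))

/-- The prefixes of the point that is computed from the answers of `σ` to the first picks. -/
def answerPrefix (σ : List Bool → Bool) : ℕ → List Bool
  | 0 => []
  | k + 1 => answerPrefix σ k ++ [σ (firstPick (encode (answerPrefix σ k)))]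

theorem exists_totalFunctional_answer : ∃ K : Baire → ℕ → ℕ, TotalFunctional K ∧
    ∀ (p r : Baire) (σ : List Bool → Bool), (∀ v, r (encode v) = encode (σ v)) →
      ∀ k, K (pairB p r) k = encode (σ (firstPick (encode (answerPrefix σ k)))) := by
  have hquery : TotalFunctional fun z c => z (2 * encode (firstPick c) + 1) :=
    TotalFunctional.second.comp (.of_primrec primrec_encode_firstPick)
  have happ : Primrec fun m : ℕ =>
      encode ((decode (α := List Bool) m.unpair.1).getD [] ++ [decide (m.unpair.2 = 1)]) :=
    Primrec.encode.comp (Primrec.list_concat.comp (Primrec.option_getD.comp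
      (Primrec.decode.comp (Primrec.fst.comp Primrec.unpair)) (Primrec.const []))
      (Primrec.eq.comp (Primrec.snd.comp Primrec.unpair) (Primrec.const 1)).decide)
  have hi : Primrec fun n : ℕ => n.unpair.2.unpair.2 :=
    Primrec.snd.comp (Primrec.unpair.comp (Primrec.snd.comp Primrec.unpair))
  -- The recursion carries the code of the prefix built so far and appends the bit found by querying
  -- the solution at the corresponding first pick.
  have hrec := ((TotalFunctional.of_primrec (Primrec.const (encode ([] : List Bool)))).prec
    ((TotalFunctional.of_primrec happ).comp
      ((TotalFunctional.of_primrec hi).pair (hquery.comp (.of_primrec hi))))).comp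
    (.of_primrec (Primrec₂.natPair.comp (Primrec.const 0) Primrec.id))
  refine ⟨_, hquery.comp hrec, fun p r σ hσ k => ?_⟩
  simp only [Nat.unpair_pair, id, pairB_odd, hσ]
  congr 4
  induction k with
  | zero => rfl
  | succ k IH =>
    simp only [answerPrefix, IH, encodek, Option.getD_some]
    cases σ (firstPick (encode (answerPrefix σ k))) <;> rfl

theorem closedChoice_le_det (n : ℕ) :
    WeihrauchLE (closedChoice.jump n) (Det (diffClass (n + 1))) := by
  obtain ⟨ψ, hψ, hlim⟩ := exists_moverWins_iff_of_isIterLim limDec_refuted n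
  obtain ⟨H, hH, hname⟩ := exists_pickGame_name hψ n
  obtain ⟨K, hK, hKσ⟩ := exists_totalFunctional_answer
  refine WeihrauchLE.of_totalFunctional hK hH fun p
    (A : TopologicalSpace.Closeds Cantor) hp hne => ?_
  obtain ⟨q, hq, hA⟩ := (Representation.iterJump_names closedRep).1 hp
  obtain ⟨hopen, hg⟩ := hname p
  have hA : ∀ x : Cantor, x ∈ A ↔ x ∉ openOf q := fun x => by
    rw [← SetLike.mem_coe, show (A : Set Cantor) = (openOf q)ᶜ from hA, Set.mem_compl_iff]
  have hwin : ¬ MoverWins (ψ p) (n + 3) [] := by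
    rw [moverWins_all_iff (k := n + 1)]
    rintro ⟨i, hi⟩
    obtain ⟨b, hb, hb'⟩ := exists_not_moverWins_refuted q i
    exact hb' ((hlim p q hq _ (by simp)).1 (hi b hb))
  refine ⟨_, hg, ⟨_, (isWinningFor_pickStrategy (a := 1) (by simpa using hwin)).isNash⟩, ?_⟩
  intro r (σ : List Bool → Bool) hσ hr
  let x : Cantor := fun k => σ (firstPick (encode (answerPrefix σ k)))
  have hpre : ∀ k, pre x k = answerPrefix σ k := by
    intro k
    induction k with
    | zero => rfl
    | succ k IH => rw [pre_succ, IH]; rfl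
  refine ⟨x, (hA x).2 (notMem_openOf fun k => ?_), fun k => hKσ p r σ hr k⟩
  -- Invariant: no prefix of `x` is ever covered. It holds at the empty word because the closed set
  -- is non-empty.
  rw [← not_exists]
  induction k with
  | zero =>
    rintro ⟨s, hs⟩
    obtain ⟨y, hy⟩ := hne
    exact (hA y).1 hy (mem_openOf_of_covered hs y)
  | succ k IH =>
    rintro ⟨s, hs⟩
    rw [pre_succ] at hs
    have hno := not_moverWins_of_isNash hσ hwin (encode (pre x k))
    rw [hlim p q hq _ (by simp), moverWins_refuted_iff] at hno
    rw [show σ (firstPick (encode (pre x k))) = x k by rw [hpre]] at hno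
    -- The chosen bit is not refuted, so if its successor is covered at stage `s`, then so is its
    -- sibling, and the shorter prefix would be covered already.
    have hs' : Covered q s (pre x k ++ [!x k]) := by
      by_contra hcon
      exact hno ⟨s, hs, hcon⟩
    refine IH (exists_covered_iff.2 fun b => ⟨s, ?_⟩)
    rcases Bool.eq_or_eq_not b (x k) with rfl | rfl
    · exact hs
    · exact hs'

end WeihrauchGames

theorem theorem15 (n : ℕ) :
    WeihrauchGames.WeihrauchEquiv
        (WeihrauchGames.Det (WeihrauchGames.diffClass (n + 1)))
        (WeihrauchGames.closedChoice.jump n) ∧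
      WeihrauchGames.WeihrauchEquiv
        (WeihrauchGames.Win (WeihrauchGames.diffClass (n + 1)))
        (WeihrauchGames.LPO.jump n) := by
  exact ⟨⟨WeihrauchGames.det_le_closedChoice n, WeihrauchGames.closedChoice_le_det n⟩,
    ⟨WeihrauchGames.win_le_lpo n, WeihrauchGames.lpo_le_win n⟩⟩
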